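/- **Setting.** A knapsack has size $k$, and $n$ items arrive at times $1,\dots,n$, where $80\le k\le n/2$. Let $\ell$ be $\frac{n\ln k}{k}$ rounded (up or down) to an integer. Split $\{1,\dots,n\}$ into consecutive windows $\{1,\dots,\ell\},\{\ell+1,\dots,2\ell\},\dots$. Let $\Gamma\ge\sqrt k$ be an integer with $\frac{\Gamma\ell}{n}\le\frac12$. The times are partitioned into random-order times $RO$ and adversarial times, and a fixed collection of at most $\Gamma$ windows (the adversarial windows) covers all adversarial times. A time is *free* if it lies in no adversarial window. There are $|RO|$ fixed random-order items with values $v_i>0$ and sizes $w_i\in(0,1]$, the densities $v_i/w_i$ are pairwise distinct, and $\sum_i w_i\ge k$. Let $\mathrm{OPT}_{RO}=\max\{\sum_i v_ix_i:\sum_i w_ix_i\le k,\ x\in[0,1]^{|RO|}\}$. A uniformly random bijection $I$ from $RO$ to the items determines the item $I_t$, with value $V_t=v_{I_t}$ and size $W_t=w_{I_t}$, that arrives at each $t\in RO$. At adversarial times an adversary outputs arbitrary values $V_t\ge 0$ and sizes $W_t\in[0,1]$, which may depend on all of $I$ and on the algorithm's behaviour. **Algorithm.** Let $a_1=601$, $c_t=1-\frac{4\Gamma\ell}{t}$,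 and let $a_4$ be a constant. At time $t$ the algorithm takes an arbitrary optimal solution $X^t$ of the linear program of maximizing $\sum_{s\le t}V_sX_s$ over $X\in[0,1]^t$ subject to $\sum_{s\le t}W_sX_s\le c_t\frac tn k$ and $\sum_{s\in B,\,s\le t}W_sX_s\le a_1\frac{\ell}{n}k$ for every window $B$ (its behaviour is unrestricted if this program is infeasible, i.e. if $c_t<0$). Let $T_t=1$ if $X^t_t>0$ and $T_t=0$ otherwise. Let $F_t=1$ (the algorithm is not blocked) if $$\sum_{s<t,\ s\text{ in the window of }t}W_sX^{alg}_s\le a_4\tfrac{\ell}{n}k-1\quad\text{and}\quad\sum_{s<t}W_sX^{alg}_s\le k-1,$$ and $F_t=0$ otherwise. The algorithm selects $X^{alg}_t=T_tF_t\in\{0,1\}$ of the item. **Theorem (Value lower bound).** For every sufficiently large constant $a_4$ there are constants $C,a_5>0$, depending only on $a_4$, such that the following holds for all instances, all adversaries and all choices of optimal LP solutions as above. Put $$p_t=\frac{C}{k\left(1-\frac tn-a_5\frac{\Gamma\ln k}{k}\right)^2}\ \text{ if } 1-\tfrac tn-a_5\tfrac{\Gamma\ln k}{k}>0,\qquad p_t=1\text{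 otherwise,}$$ $$\varepsilon_t=(a_1+3)\frac{\Gamma\ell}{t}+\sqrt{10\ln k}\,\sqrt{\frac{2n}{tk}}.$$ Then $p_t$ bounds the probability of being blocked, i.e. $\Pr(F_t=0\mid I_t=i)\le p_t$ for every free time $t\ge 8\ell(\Gamma+2)$ and every item $i$; and for every free time $t\ge 1212\,\Gamma\ell$ the expected value collected at time $t$ satisfies $$\mathbb E[V_tT_tF_t]\ \ge\ \left(c_t-\varepsilon_t-p_t-\frac2k\right)\frac{\mathrm{OPT}_{RO}}{|RO|}.$$ -/

import Mathlib

/-- The non-adaptive data of the knapsack problem with bursty adversary plus random order, together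
with the standing assumptions on them. Times are `1, …, n`; the windows are the consecutive blocks
`{1, …, ℓ}, {ℓ + 1, …, 2ℓ}, …`, the `j`-th one (from `j = 0`) being `{t : (t - 1) / ℓ = j}`. -/
structure BARO where
  /-- number of items -/
  n : ℕ
  /-- knapsack size -/
  k : ℝ
  /-- number of windows that may contain adversarial times -/
  Γ : ℕ
  /-- window length: `n ln k / k`, rounded up or down to an integer -/
  ℓ : ℕ
  /-- the random-order times; all other times in `{1, …, n}` are adversarial -/
  RO : Finset ℕ
  /-- indices of the adversarial windows -/
  Wadv : Finset ℕ
  /-- values of the random-order items -/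
  v : Fin RO.card → ℝ
  /-- sizes of the random-order items -/
  w : Fin RO.card → ℝ
  k_ge : 80 ≤ k
  k_le : k ≤ (n : ℝ) / 2
  ℓ_round : |(ℓ : ℝ) - n * Real.log k / k| < 1
  Γ_ge : Real.sqrt k ≤ Γ
  Γℓ_le : (Γ : ℝ) * ℓ / n ≤ 1 / 2
  RO_subset : RO ⊆ Finset.Icc 1 n
  card_Wadv : Wadv.card ≤ Γ
  adv_covered : ∀ t ∈ Finset.Icc 1 n, t ∉ RO → (t - 1) / ℓ ∈ Wadv
  v_pos : ∀ i, 0 < v i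
  w_pos : ∀ i, 0 < w i
  w_le_one : ∀ i, w i ≤ 1
  density_injective : Function.Injective fun i => v i / w i
  k_le_sum_w : k ≤ ∑ i, w i

namespace BARO

noncomputable section

variable (P : BARO)

/-- The index of the window containing time `t ≥ 1`. -/
def window (t : ℕ) : ℕ := (t - 1) / P.ℓ

/-- A free time: a time outside all adversarial windows. -/
def IsFree (t : ℕ) : Prop := t ∈ Finset.Icc 1 P.n ∧ P.window t ∉ P.Wadv

variable {P} in
theorem IsFree.mem_RO {t : ℕ} (h : P.IsFree t) : t ∈ P.RO := by
  by_contra h'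
  exact h.2 (P.adv_covered t h.1 h')

/-- The outcomes of sampling the random-order items without replacement: `I t` is the index of
the item that arrives at the random-order time `t`. All outcomes are equally likely. -/
abbrev Arrival : Type := P.RO ≃ Fin P.RO.card

/-- Expectation over the uniformly random arrival order. -/
def expect (f : P.Arrival → ℝ) : ℝ := (∑ I, f I) / Fintype.card P.Arrival

open Classical in
/-- The conditional probability of the event `E` given that item `i` arrives at time `t`. -/
def condProb (E : P.Arrival → Prop) (t : P.RO) (i : Fin P.RO.card) : ℝ :=
  ((Finset.univ.filter fun I : P.Arrival => I t = i ∧ E I).card : ℝ) /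
    (Finset.univ.filter fun I : P.Arrival => I t = i).card

/-- The items (value `V I t` and size `W I t`) output at each time `t` for each arrival order `I`:
prescribed at the random-order times, arbitrary at the adversarial times, where they may depend on
the whole of `I` (and thereby on everything the algorithm does). -/
structure Adversary where
  V : P.Arrival → ℕ → ℝ
  W : P.Arrival → ℕ → ℝ
  V_nonneg : ∀ I, ∀ t ∈ Finset.Icc 1 P.n, 0 ≤ V I t
  W_mem : ∀ I, ∀ t ∈ Finset.Icc 1 P.n, W I t ∈ Set.Icc (0 : ℝ) 1
  V_RO : ∀ I, ∀ t : P.RO, V I t = P.v (I t)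
  W_RO : ∀ I, ∀ t : P.RO, W I t = P.w (I t)

/-- The constant in the inner constraints. -/
def a₁ : ℝ := 601

/-- The budget scaling `c_t`. -/
def c (t : ℕ) : ℝ := 1 - 4 * P.Γ * P.ℓ / t

/-- Feasibility of `x` for the linear program `LP_t`, for sizes `W`. -/
def LPFeasible (W : ℕ → ℝ) (t : ℕ) (x : ℕ → ℝ) : Prop :=
  (∀ s ∈ Finset.Icc 1 t, x s ∈ Set.Icc (0 : ℝ) 1) ∧
  ∑ s ∈ Finset.Icc 1 t, W s * x s ≤ P.c t * (t / P.n) * P.k ∧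
  ∀ j : ℕ, ∑ s ∈ Finset.Icc 1 t with P.window s = j, W s * x s ≤ a₁ * (P.ℓ / P.n) * P.k

/-- Optimality of `x` for the linear program `LP_t`, for values `V` and sizes `W`. -/
def LPOptimal (V W : ℕ → ℝ) (t : ℕ) (x : ℕ → ℝ) : Prop :=
  P.LPFeasible W t x ∧ ∀ y, P.LPFeasible W t y →
    ∑ s ∈ Finset.Icc 1 t, V s * y s ≤ ∑ s ∈ Finset.Icc 1 t, V s * x s

/-- `X I t` is the optimal solution of `LP_t` that the algorithm uses. Ties between optimal
solutions are broken arbitrarily, and nothing is assumed about the early times at which `LP_t` is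
infeasible (those with `c_t < 0`). -/
def IsLPChoice (A : P.Adversary) (X : P.Arrival → ℕ → ℕ → ℝ) : Prop :=
  ∀ I, ∀ t ∈ Finset.Icc 1 P.n, (∃ y, P.LPFeasible (A.W I) t y) →
    P.LPOptimal (A.V I) (A.W I) t (X I t)

open Classical in
/-- The selection `X^alg_t ∈ {0, 1}` of the algorithm at time `t`, for sizes `W` and LP solutions
`X`: the item is picked iff it is tentatively picked (`X^t_t > 0`) and the past selections satisfy
the main budget and the outer constraint for the window containing `t`. -/
def algSel (a₄ : ℝ) (W : ℕ → ℝ) (X : ℕ → ℕ → ℝ) (t : ℕ) : ℝ :=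
  if 0 < X t t ∧
      ∑ s ∈ ((Finset.Ico 1 t).filter fun s => P.window s = P.window t).attach,
        W s * algSel a₄ W X s ≤ a₄ * (P.ℓ / P.n) * P.k - 1 ∧
      ∑ s ∈ (Finset.Ico 1 t).attach, W s * algSel a₄ W X s ≤ P.k - 1
  then 1 else 0
termination_by t
decreasing_by
  · exact (Finset.mem_Ico.1 (Finset.mem_filter.1 s.2).1).2
  · exact (Finset.mem_Ico.1 s.2).2

open Classical in
/-- The indicator `T_t` of a tentative selection. -/
def T (X : ℕ → ℕ → ℝ) (t : ℕ) : ℝ := if 0 < X t t then 1 else 0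

open Classical in
/-- The indicator `F_t` of not being blocked at time `t`. -/
def F (a₄ : ℝ) (W : ℕ → ℝ) (X : ℕ → ℕ → ℝ) (t : ℕ) : ℝ :=
  if ∑ s ∈ Finset.Ico 1 t with P.window s = P.window t, W s * P.algSel a₄ W X s
        ≤ a₄ * (P.ℓ / P.n) * P.k - 1 ∧
      ∑ s ∈ Finset.Ico 1 t, W s * P.algSel a₄ W X s ≤ P.k - 1
  then 1 else 0

/-- `X^alg_t = T_t F_t`. -/
theorem algSel_eq (a₄ : ℝ) (W : ℕ → ℝ) (X : ℕ → ℕ → ℝ) (t : ℕ) :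
    P.algSel a₄ W X t = T X t * P.F a₄ W X t := by
  rw [algSel, T, F]
  rw [Finset.sum_attach (Finset.Ico 1 t) (fun s => W s * P.algSel a₄ W X s),
    Finset.sum_attach ((Finset.Ico 1 t).filter fun s => P.window s = P.window t)
      (fun s => W s * P.algSel a₄ W X s)]
  split_ifs <;> simp_all

/-- The offline fractional optimum over the random-order items. -/
def OPT : ℝ :=
  sSup {y : ℝ | ∃ x : Fin P.RO.card → ℝ, (∀ i, x i ∈ Set.Icc (0 : ℝ) 1) ∧
    ∑ i, P.w i * x i ≤ P.k ∧ y = ∑ i, P.v i * x i}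

/-- The error term `ε_t`. -/
def ε (t : ℕ) : ℝ :=
  (a₁ + 3) * (P.Γ * P.ℓ / t) + Real.sqrt (10 * Real.log P.k) * Real.sqrt (2 * P.n / (t * P.k))

open Classical in
/-- The blocking bound `p_t = C / (k (1 - t/n - a₅ Γ ln k / k)²)`, meant for positive
`1 - t/n - a₅ Γ ln k / k`; at the remaining, late times it is the trivial bound `1`. -/
def p (C a₅ : ℝ) (t : ℕ) : ℝ :=
  if 0 < 1 - t / P.n - a₅ * (P.Γ * Real.log P.k / P.k) then
    C / (P.k * (1 - t / P.n - a₅ * (P.Γ * Real.log P.k / P.k)) ^ 2)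
  else 1

end

end BARO

/-! Write B for `windowBudget`, i.e. ℓk/n, which rounding keeps within 1/2 of ln k. Adversarial
times are shown to disturb the algorithm only by sizes of order ΓB, and everything else is governed
by the arrival order alone. The set `densest γ` has total size between γk and γk + 1 and value at
least γ·OPT (for 0 < γ ≤ 1). Exchange arguments (`LPOptimal.sum_denser_le`,
`LPOptimal.le_sum_denser`) convert statements about an arbitrary optimal LP solution into statements
about the total size of dense items at free times. That size is a function of I only, so neither the
adaptivity of the adversary nor the tie-breaking matters. Given I_t = i, its moment generating
function obeys a Poisson-type bound (`sum_exp_le_card_mul_exp`), and Chernoff's method applies.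

Blocking: with conditional probability at least 1 - 2/k the order is `Typical`. Then no item outside
`densest 1` is tentatively picked at a free time s < t with s ≥ 4Γℓ: otherwise all dense items seen
so far would fit into the LP budget, which c_s has lowered by 4ΓB (`Typical.mem_densest`). The
adversarial windows and the first 4Γ windows hold at most a₄B each by the outer constraint, and the
window of t is not full because a₄ exceeds a₁. So t can only be blocked by the main budget, which
requires the dense items to exceed their mean by k times the bracket in p_t (`condProb_blocked_le`).

Value: put γ = c_t - ε_t. If an item of `densest γ` arrives at t and X^t_t = 0, then earlier dense
items at free times either fill the window of t or nearly exhaust the budget. Each event has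
probability at most 1/k (`condProb_not_selected_le`). A union bound with p_t, summed over `densest
γ`, gives the claim. -/

/-! ### Sampling without replacement: uniformly random bijections with one value prescribed -/

section Bijections

open Finset

variable {α β : Type*} [Fintype α] [DecidableEq α] [Fintype β] [DecidableEq β]

/-- Precomposing with a transposition away from `t` permutes the bijections sending `t` to `i`. -/
theorem sum_equiv_fixing_comp_swap (t : α) (i : β) {a c : α} (ha : a ≠ t) (hc : c ≠ t)
    (Φ : (α ≃ β) → ℝ) :
    ∑ I : α ≃ β with I t = i, Φ ((Equiv.swap a c).trans I) = ∑ I : α ≃ β with I t = i, Φ I := by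
  refine Finset.sum_nbij' (fun I => (Equiv.swap a c).trans I)
    (fun I => (Equiv.swap a c).trans I) ?_ ?_ ?_ ?_ ?_
  · intro I hI
    simpa [Equiv.swap_apply_of_ne_of_ne ha.symm hc.symm] using hI
  · intro I hI
    simpa [Equiv.swap_apply_of_ne_of_ne ha.symm hc.symm] using hI
  · intro I _
    ext x
    simp
  · intro I _
    ext x
    simp
  · intro I _
    rfl

/-- Replacing a fresh factor by any other factor does not decrease the average of a product over
a sample without replacement. -/
theorem sum_prod_insert_le (t : α) (i : β) (g : β → ℝ) (hg : ∀ b, 0 ≤ g b) (S : Finset α)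
    {a c : α} (ha : a ≠ t) (haS : a ∉ S) (hc : c ≠ t) :
    ∑ I : α ≃ β with I t = i, ∏ s ∈ insert a S, g (I s) ≤
      ∑ I : α ≃ β with I t = i, (∏ s ∈ S, g (I s)) * g (I c) := by
  -- If c is already in S, the right side contains g(I c)². Use g(I a)g(I c) ≤ (g(I a)² + g(I
  -- c)²)/2; swapping a and c shows that both squares contribute the same sum. If c is fresh, the
  -- swap gives equality.
  by_cases hcS : c ∈ S
  · have hac : a ≠ c := fun h => haS (h ▸ hcS)
    set R := S.erase c with hR
    have haR : a ∉ R := fun h => haS (Finset.mem_of_mem_erase h)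
    have hcR : c ∉ R := Finset.notMem_erase c S
    have hS : S = insert c R := (Finset.insert_erase hcS).symm
    have h1 := sum_equiv_fixing_comp_swap t i ha hc
      (fun I => (∏ s ∈ R, g (I s)) * g (I c) * g (I c))
    have h2 : ∀ I : α ≃ β, ∏ s ∈ R, g (((Equiv.swap a c).trans I) s) = ∏ s ∈ R, g (I s) := by
      intro I
      refine Finset.prod_congr rfl fun s hs => ?_
      have hsa : s ≠ a := fun h => haR (h ▸ hs)
      have hsc : s ≠ c := fun h => hcR (h ▸ hs)
      simp [Equiv.swap_apply_of_ne_of_ne hsa hsc]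
    simp only [h2] at h1
    simp only [Equiv.trans_apply, Equiv.swap_apply_right] at h1
    have h3 : ∑ I : α ≃ β with I t = i, ∏ s ∈ insert a S, g (I s) =
        ∑ I : α ≃ β with I t = i, (∏ s ∈ R, g (I s)) * (g (I a) * g (I c)) := by
      refine Finset.sum_congr rfl fun I _ => ?_
      rw [Finset.prod_insert haS, hS, Finset.prod_insert hcR]
      ring
    have h4 : ∑ I : α ≃ β with I t = i, (∏ s ∈ S, g (I s)) * g (I c) =
        ∑ I : α ≃ β with I t = i, (∏ s ∈ R, g (I s)) * g (I c) * g (I c) := by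
      refine Finset.sum_congr rfl fun I _ => ?_
      rw [hS, Finset.prod_insert hcR]
      ring
    rw [h3, h4]
    have h5 : 2 * ∑ I : α ≃ β with I t = i, (∏ s ∈ R, g (I s)) * (g (I a) * g (I c)) ≤
        ∑ I : α ≃ β with I t = i, (∏ s ∈ R, g (I s)) * g (I a) * g (I a) +
        ∑ I : α ≃ β with I t = i, (∏ s ∈ R, g (I s)) * g (I c) * g (I c) := by
      rw [Finset.mul_sum, ← Finset.sum_add_distrib]
      refine Finset.sum_le_sum fun I _ => ?_
      have := mul_nonneg (Finset.prod_nonneg fun s (_ : s ∈ R) => hg (I s))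
        (sq_nonneg (g (I a) - g (I c)))
      nlinarith
    linarith
  · have h1 := sum_equiv_fixing_comp_swap t i ha hc
      (fun I => (∏ s ∈ S, g (I s)) * g (I c))
    rw [← h1]
    refine le_of_eq (Finset.sum_congr rfl fun I _ => ?_)
    rw [Finset.prod_insert haS, mul_comm]
    congr 1
    · refine Finset.prod_congr rfl fun s hs => ?_
      have hsa : s ≠ a := fun h => haS (h ▸ hs)
      have hsc : s ≠ c := fun h => hcS (h ▸ hs)
      simp [Equiv.swap_apply_of_ne_of_ne hsa hsc]
    · simp

/-- Average `sum_prod_insert_le` over all c ≠ t: as I is a bijection with I t = i, the values g(I c)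
over c ≠ t add up to the full sum minus g i. -/
theorem card_sub_one_mul_sum_prod_insert_le (t : α) (i : β) (g : β → ℝ) (hg : ∀ b, 0 ≤ g b)
    (S : Finset α) {a : α} (ha : a ≠ t) (haS : a ∉ S) :
    ((Fintype.card α : ℝ) - 1) * ∑ I : α ≃ β with I t = i, ∏ s ∈ insert a S, g (I s) ≤
      ((∑ b, g b) - g i) * ∑ I : α ≃ β with I t = i, ∏ s ∈ S, g (I s) := by
  have h1 : ∑ c ∈ univ.erase t, ∑ I : α ≃ β with I t = i, ∏ s ∈ insert a S, g (I s) ≤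
      ∑ c ∈ univ.erase t, ∑ I : α ≃ β with I t = i, (∏ s ∈ S, g (I s)) * g (I c) :=
    Finset.sum_le_sum fun c hc =>
      sum_prod_insert_le t i g hg S ha haS (Finset.ne_of_mem_erase hc)
  rw [Finset.sum_const, Finset.card_erase_of_mem (Finset.mem_univ t), nsmul_eq_mul,
    Finset.card_univ, Nat.cast_sub (Fintype.card_pos_iff.2 ⟨t⟩), Finset.sum_comm] at h1
  refine (le_of_eq (by simp)).trans (h1.trans (le_of_eq ?_))
  rw [Finset.mul_sum]
  refine Finset.sum_congr rfl fun I hI => ?_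
  have hI' : I t = i := (Finset.mem_filter.1 hI).2
  rw [← Finset.mul_sum, mul_comm]
  congr 1
  rw [← Finset.sum_erase_add _ _ (Finset.mem_univ i), add_sub_cancel_right]
  refine Finset.sum_nbij' I I.symm ?_ ?_ ?_ ?_ ?_ <;> simp [← hI', Equiv.symm_apply_eq]

/-- For a uniformly random bijection conditioned on `I t = i`, a product over a set of places is
on average at most the product of the averages. -/
theorem sum_prod_le_card_mul_pow (t : α) (i : β) (hcard : 2 ≤ Fintype.card α) (g : β → ℝ)
    (hg : ∀ b, 0 ≤ g b) (S : Finset α) (htS : t ∉ S) :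
    ∑ I : α ≃ β with I t = i, ∏ s ∈ S, g (I s) ≤
      (#{I : α ≃ β | I t = i} : ℝ) *
        (((∑ b, g b) - g i) / ((Fintype.card α : ℝ) - 1)) ^ #S := by
  have hN : (0 : ℝ) < (Fintype.card α : ℝ) - 1 := by
    have : (2 : ℝ) ≤ Fintype.card α := by exact_mod_cast hcard
    linarith
  have hG : 0 ≤ (∑ b, g b) - g i :=
    sub_nonneg.2 (Finset.single_le_sum (fun b _ => hg b) (Finset.mem_univ i))
  induction S using Finset.induction_on with
  | empty => simp
  | insert a S haS ih =>
    have htS' : t ∉ S := fun h => htS (Finset.mem_insert_of_mem h)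
    have ha : a ≠ t := fun h => htS (h ▸ Finset.mem_insert_self a S)
    have h1 := card_sub_one_mul_sum_prod_insert_le t i g hg S ha haS
    have h2 := mul_le_mul_of_nonneg_left (ih htS') hG
    rw [Finset.card_insert_of_notMem haS, pow_succ, ← mul_assoc, mul_div_assoc', le_div_iff₀ hN]
    nlinarith

/-- Moment generating function bound for sampling without replacement. -/
theorem sum_exp_le_card_mul_exp (t : α) (i : β) (hcard : 2 ≤ Fintype.card α) (f : β → ℝ)
    (hβ : Fintype.card β = Fintype.card α)
    (hf : ∀ b, f b ∈ Set.Icc (0 : ℝ) 1) (S : Finset α) (htS : t ∉ S) (r : ℝ) :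
    ∑ I : α ≃ β with I t = i, Real.exp (r * ∑ s ∈ S, f (I s)) ≤
      (#{I : α ≃ β | I t = i} : ℝ) *
        Real.exp (#S / ((Fintype.card α : ℝ) - 1) * ((∑ b, f b) - f i) * (Real.exp r - 1)) := by
  have hN : (0 : ℝ) < (Fintype.card α : ℝ) - 1 := by
    have : (2 : ℝ) ≤ Fintype.card α := by exact_mod_cast hcard
    linarith
  have h1 := sum_prod_le_card_mul_pow t i hcard (fun b => Real.exp (r * f b))
    (fun b => (Real.exp_pos _).le) S htS
  have h2 : ∀ I : α ≃ β, Real.exp (r * ∑ s ∈ S, f (I s)) = ∏ s ∈ S, Real.exp (r * f (I s)) := by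
    intro I
    rw [Finset.mul_sum, Real.exp_sum]
  simp only [h2]
  refine h1.trans (mul_le_mul_of_nonneg_left ?_ (Nat.cast_nonneg _))
  -- The chord of the convex exponential between 0 and r. Averaging it over b ≠ i and using 1 + x ≤
  -- exp x gives the Poisson-type factor.
  have hconv : ∀ b, Real.exp (r * f b) ≤ 1 + f b * (Real.exp r - 1) := by
    intro b
    have := convexOn_exp.2 (Set.mem_univ (0 : ℝ)) (Set.mem_univ r)
      (sub_nonneg.2 (hf b).2) (hf b).1 (by ring)
    simp only [smul_eq_mul, mul_zero, zero_add, Real.exp_zero, mul_one] at this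
    rw [mul_comm r]
    linarith
  have hsplit : ∀ g : β → ℝ, (∑ b, g b) - g i = ∑ b ∈ univ.erase i, g b := by
    intro g
    rw [← Finset.sum_erase_add _ _ (Finset.mem_univ i), add_sub_cancel_right]
  have hcardE : ((univ.erase i).card : ℝ) = (Fintype.card α : ℝ) - 1 := by
    rw [Finset.card_erase_of_mem (Finset.mem_univ i), Finset.card_univ, hβ,
      Nat.cast_sub (by omega)]
    simp
  have h3 : ((∑ b, Real.exp (r * f b)) - Real.exp (r * f i)) / ((Fintype.card α : ℝ) - 1) ≤
      Real.exp (((∑ b, f b) - f i) * (Real.exp r - 1) / ((Fintype.card α : ℝ) - 1)) := by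
    refine le_trans ?_ (Real.add_one_le_exp _)
    rw [hsplit f, hsplit fun b => Real.exp (r * f b), div_add_one hN.ne',
      div_le_div_iff_of_pos_right hN, ← hcardE, Finset.sum_mul]
    refine (Finset.sum_le_sum fun b _ => hconv b).trans (le_of_eq ?_)
    rw [Finset.sum_add_distrib]
    simp [add_comm]
  refine (pow_le_pow_left₀ (div_nonneg ?_ hN.le) h3 _).trans (le_of_eq ?_)
  · rw [hsplit fun b => Real.exp (r * f b)]
    exact Finset.sum_nonneg fun b _ => (Real.exp_pos _).le
  · rw [← Real.exp_nat_mul]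
    congr 1
    ring

/-- The events `I t = i` are equally likely for all `i`. -/
theorem card_mul_card_equiv_fixing (t : α) (i : β) :
    Fintype.card β * #{I : α ≃ β | I t = i} = Fintype.card (α ≃ β) := by
  have h : ∀ j : β, #{I : α ≃ β | I t = j} = #{I : α ≃ β | I t = i} := by
    intro j
    refine Finset.card_nbij' (fun I => I.trans (Equiv.swap i j))
      (fun I => I.trans (Equiv.swap i j)) ?_ ?_ ?_ ?_
    · intro I hI
      have : I t = j := by simpa using hI
      simp [this]
    · intro I hI
      have : I t = i := by simpa using hI
      simp [this]
    · intro I _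
      ext x
      simp
    · intro I _
      ext x
      simp
  have h1 := Finset.card_eq_sum_card_fiberwise (s := (univ : Finset (α ≃ β)))
    (f := fun I : α ≃ β => I t) (t := univ) (by simp)
  simp only [h, Finset.sum_const, Finset.card_univ, smul_eq_mul] at h1
  exact h1.symm

end Bijections

namespace BARO

open Finset

/-! ### The linear program and the algorithm -/

section LinearProgram

variable {P : BARO}

/-- Evaluates objective and constraints at the perturbed solution of the exchange argument below. -/
theorem sum_mul_shift (S : Finset ℕ) (U x : ℕ → ℝ) {r s : ℕ} (p q : ℝ) :
    ∑ u ∈ S, U u * (x u + (if u = s then p else 0) - (if u = r then q else 0)) =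
      ∑ u ∈ S, U u * x u + (if s ∈ S then U s * p else 0) - (if r ∈ S then U r * q else 0) := by
  simp only [mul_sub, mul_add, mul_ite, mul_zero, Finset.sum_sub_distrib, Finset.sum_add_distrib,
    Finset.sum_ite_eq']

/-- In an optimal LP solution no size can be moved from an item to a denser one. -/
theorem LPOptimal.no_swap {V W : ℕ → ℝ} {t : ℕ} {x : ℕ → ℝ} (hx : P.LPOptimal V W t x)
    {r s : ℕ} (hr : r ∈ Icc 1 t) (hs : s ∈ Icc 1 t) (hWr : 0 < W r) (hWs : 0 < W s)
    (hxr : 0 < x r) (hxs : x s < 1) (hdens : V r * W s < V s * W r)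
    (hwin : P.window r = P.window s ∨
      ∑ u ∈ Icc 1 t with P.window u = P.window s, W u * x u < a₁ * (P.ℓ / P.n) * P.k) :
    False := by
  have hrs : r ≠ s := by
    rintro rfl
    exact lt_irrefl _ hdens
  obtain ⟨⟨hbox, hbud, hinner⟩, hopt⟩ := hx
  -- Raising x s by η·W r and lowering x r by η·W s leaves the used size unchanged and changes the
  -- value by η(V s·W r - V r·W s) > 0. Only the window of s can overflow, and only if r lies
  -- elsewhere; the last condition on η excludes this.
  obtain ⟨η, hη, h1, h2, h3⟩ : ∃ η : ℝ, 0 < η ∧ η * W r ≤ 1 - x s ∧ η * W s ≤ x r ∧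
      (P.window r = P.window s ∨ ∑ u ∈ Icc 1 t with P.window u = P.window s, W u * x u +
        W s * (η * W r) ≤ a₁ * (P.ℓ / P.n) * P.k) := by
    rcases hwin with h | h
    · refine ⟨min ((1 - x s) / W r) (x r / W s), ?_, ?_, ?_, Or.inl h⟩
      · exact lt_min (div_pos (by linarith) hWr) (div_pos hxr hWs)
      · exact (le_div_iff₀ hWr).1 (min_le_left _ _)
      · exact (le_div_iff₀ hWs).1 (min_le_right _ _)
    · set d := a₁ * (P.ℓ / P.n) * P.k - ∑ u ∈ Icc 1 t with P.window u = P.window s, W u * x u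
        with hd
      have hd0 : 0 < d := by linarith
      refine ⟨min (min ((1 - x s) / W r) (x r / W s)) (d / (W s * W r)), ?_, ?_, ?_, Or.inr ?_⟩
      · exact lt_min (lt_min (div_pos (by linarith) hWr) (div_pos hxr hWs))
          (div_pos hd0 (mul_pos hWs hWr))
      · exact (le_div_iff₀ hWr).1 ((min_le_left _ _).trans (min_le_left _ _))
      · exact (le_div_iff₀ hWs).1 ((min_le_left _ _).trans (min_le_right _ _))
      · have h4 := (le_div_iff₀ (mul_pos hWs hWr)).1
          (min_le_right (min ((1 - x s) / W r) (x r / W s)) (d / (W s * W r)))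
        nlinarith
  have hpr : 0 < η * W r := mul_pos hη hWr
  have hps : 0 < η * W s := mul_pos hη hWs
  have hfeas : P.LPFeasible W t
      (fun u => x u + (if u = s then η * W r else 0) - (if u = r then η * W s else 0)) := by
    refine ⟨fun u hu => ?_, ?_, fun j => ?_⟩
    · have hxu := hbox u hu
      by_cases hus : u = s
      · subst hus
        simp only [if_true, if_neg hrs.symm, sub_zero]
        exact ⟨by linarith [hxu.1], by linarith⟩
      · by_cases hur : u = r
        · subst hur
          simp only [if_true, if_neg hus, add_zero]
          exact ⟨by linarith, by linarith [hxu.2]⟩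
        · simpa [hus, hur] using hxu
    · rw [sum_mul_shift, if_pos hs, if_pos hr]
      nlinarith
    · rw [sum_mul_shift]
      simp only [Finset.mem_filter, hs, hr, true_and]
      have hj := hinner j
      by_cases hsj : P.window s = j
      · by_cases hrj : P.window r = j
        · rw [if_pos hsj, if_pos hrj]
          nlinarith
        · rw [if_pos hsj, if_neg hrj]
          rcases h3 with h3 | h3
          · exact absurd (h3.trans hsj) hrj
          · rw [hsj] at h3
            linarith
      · rw [if_neg hsj]
        split_ifs
        · nlinarith [mul_pos hWr hps]
        · linarith
  have h := hopt _ hfeas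
  rw [sum_mul_shift, if_pos hs, if_pos hr] at h
  nlinarith

/-- In an optimal LP solution a valuable item that is not fully picked is kept out by the main
budget or by the inner constraint of its window. -/
theorem LPOptimal.tight {V W : ℕ → ℝ} {t : ℕ} {x : ℕ → ℝ} (hx : P.LPOptimal V W t x)
    {s : ℕ} (hs : s ∈ Icc 1 t) (hWs : 0 < W s) (hVs : 0 < V s) (hxs : x s < 1)
    (hwin : ∑ u ∈ Icc 1 t with P.window u = P.window s, W u * x u < a₁ * (P.ℓ / P.n) * P.k) :
    P.c t * (t / P.n) * P.k ≤ ∑ u ∈ Icc 1 t, W u * x u := by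
  by_contra! hbud'
  obtain ⟨⟨hbox, hbud, hinner⟩, hopt⟩ := hx
  set d := min (a₁ * (P.ℓ / P.n) * P.k - ∑ u ∈ Icc 1 t with P.window u = P.window s, W u * x u)
    (P.c t * (t / P.n) * P.k - ∑ u ∈ Icc 1 t, W u * x u) with hd
  have hd0 : 0 < d := lt_min (by linarith) (by linarith)
  have hd1 := min_le_left
    (a₁ * (P.ℓ / P.n) * P.k - ∑ u ∈ Icc 1 t with P.window u = P.window s, W u * x u)
    (P.c t * (t / P.n) * P.k - ∑ u ∈ Icc 1 t, W u * x u)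
  have hd2 := min_le_right
    (a₁ * (P.ℓ / P.n) * P.k - ∑ u ∈ Icc 1 t with P.window u = P.window s, W u * x u)
    (P.c t * (t / P.n) * P.k - ∑ u ∈ Icc 1 t, W u * x u)
  rw [← hd] at hd1 hd2
  obtain ⟨η, hη, h1, h2⟩ : ∃ η : ℝ, 0 < η ∧ η ≤ 1 - x s ∧ W s * η ≤ d := by
    refine ⟨min (1 - x s) (d / W s), lt_min (by linarith) (div_pos hd0 hWs), min_le_left _ _, ?_⟩
    have := (le_div_iff₀ hWs).1 (min_le_right (1 - x s) (d / W s))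
    linarith
  have hsum : ∀ (S : Finset ℕ) (U : ℕ → ℝ), ∑ u ∈ S, U u * (x u + if u = s then η else 0) =
      ∑ u ∈ S, U u * x u + if s ∈ S then U s * η else 0 := by
    intro S U
    simp only [mul_add, mul_ite, mul_zero, Finset.sum_add_distrib, Finset.sum_ite_eq']
  have hfeas : P.LPFeasible W t (fun u => x u + if u = s then η else 0) := by
    refine ⟨fun u hu => ?_, ?_, fun j => ?_⟩
    · have hxu := hbox u hu
      by_cases hus : u = s
      · subst hus
        simp only [if_true]
        exact ⟨by linarith [hxu.1], by linarith⟩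
      · simpa [hus] using hxu
    · rw [hsum, if_pos hs]
      linarith
    · rw [hsum]
      simp only [Finset.mem_filter, hs, true_and]
      split_ifs with hj
      · subst hj
        linarith
      · linarith [hinner j]
  have h := hopt _ hfeas
  rw [hsum, if_pos hs] at h
  linarith [mul_pos hVs hη]

/-- If the last item is picked, then the strictly denser items fit into the LP budget, provided
that they obey the inner constraints. -/
theorem LPOptimal.sum_denser_le {V W : ℕ → ℝ} {t : ℕ} {x : ℕ → ℝ} (hx : P.LPOptimal V W t x)
    (ht : t ∈ Icc 1 t) (hW : ∀ u ∈ Icc 1 t, 0 ≤ W u) (hWt : 0 < W t) (hxt : 0 < x t)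
    {D : Finset ℕ} (hD : D ⊆ Icc 1 t) (hWD : ∀ u ∈ D, 0 < W u)
    (hdens : ∀ u ∈ D, V t * W u < V u * W t)
    (hwin : ∀ j, ∑ u ∈ D with P.window u = j, W u ≤ a₁ * (P.ℓ / P.n) * P.k) :
    ∑ u ∈ D, W u ≤ P.c t * (t / P.n) * P.k := by
  -- Window by window: either the inner constraint is tight and already dominates D, or it has slack
  -- and `no_swap` forces every denser item to be fully picked.
  have hmain : ∀ j, ∑ u ∈ D with P.window u = j, W u ≤
      ∑ u ∈ Icc 1 t with P.window u = j, W u * x u := by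
    intro j
    by_cases hj : ∑ u ∈ Icc 1 t with P.window u = j, W u * x u < a₁ * (P.ℓ / P.n) * P.k
    · have h1 : ∑ u ∈ D with P.window u = j, W u = ∑ u ∈ D with P.window u = j, W u * x u := by
        refine Finset.sum_congr rfl fun u hu => ?_
        obtain ⟨hu, huj⟩ := Finset.mem_filter.1 hu
        have hxu : x u = 1 := by
          refine le_antisymm (hx.1.1 u (hD hu)).2 ?_
          by_contra! hlt
          exact hx.no_swap ht (hD hu) hWt (hWD u hu) hxt hlt (hdens u hu)
            (Or.inr (by rw [huj]; exact hj))
        rw [hxu, mul_one]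
      rw [h1]
      refine Finset.sum_le_sum_of_subset_of_nonneg (Finset.filter_subset_filter _ hD) ?_
      intro u hu _
      have hu' := (Finset.mem_filter.1 hu).1
      exact mul_nonneg (hW u hu') (hx.1.1 u hu').1
    · exact (hwin j).trans (not_lt.1 hj)
  have hmaps : ∀ S ⊆ Icc 1 t, ∀ u ∈ S, P.window u ∈ range (t + 1) := by
    intro S hS u hu
    have h1 := (Finset.mem_Icc.1 (hS hu)).2
    have h2 : P.window u ≤ u - 1 := Nat.div_le_self _ _
    exact Finset.mem_range.2 (by omega)
  refine le_trans ?_ hx.1.2.1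
  rw [← Finset.sum_fiberwise_of_maps_to (hmaps D hD),
    ← Finset.sum_fiberwise_of_maps_to (hmaps (Icc 1 t) subset_rfl)]
  exact Finset.sum_le_sum fun j _ => hmain j

/-- If the last item is not picked at all, then the items at least as dense either fill its window
or, together with the windows in `J`, use up the main budget. -/
theorem LPOptimal.le_sum_denser {V W : ℕ → ℝ} {t : ℕ} {x : ℕ → ℝ} (hx : P.LPOptimal V W t x)
    (ht : t ∈ Icc 1 t) (hW : ∀ u ∈ Icc 1 t, 0 ≤ W u) (hWt : 0 < W t) (hVt : 0 < V t)
    (hxt : x t = 0) (J : Finset ℕ) (htJ : P.window t ∉ J)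
    {D : Finset ℕ} (hD : ∀ u ∈ Ico 1 t, P.window u ∉ J → V t * W u ≤ V u * W t → u ∈ D)
    (hWD : ∀ u ∈ D, 0 ≤ W u) :
    a₁ * (P.ℓ / P.n) * P.k ≤ ∑ u ∈ D with P.window u = P.window t, W u ∨
      P.c t * (t / P.n) * P.k - #J * (a₁ * (P.ℓ / P.n) * P.k) ≤ ∑ u ∈ D, W u := by
  have hle : ∀ S ⊆ Icc 1 t, (∀ u ∈ S, P.window u ∉ J) →
      (∀ u ∈ S, P.window u = P.window t ∨
        ∑ u ∈ Icc 1 t with P.window u = P.window t, W u * x u < a₁ * (P.ℓ / P.n) * P.k) →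
      ∀ q : ℕ → Prop, [DecidablePred q] → (∀ u ∈ S, q u) →
      ∑ u ∈ S, W u * x u ≤ ∑ u ∈ D with q u, W u := by
    intro S hS hSJ hSw q _ hq
    -- Terms with zero contribution are dropped, since `no_swap` needs positive size and positive
    -- mass. A remaining item less dense than the one at t could be traded for it, so all remaining
    -- items lie in D.
    have h1 : ∑ u ∈ S with 0 < W u * x u, W u * x u = ∑ u ∈ S, W u * x u := by
      refine Finset.sum_filter_of_ne fun u hu hne => ?_
      exact lt_of_le_of_ne (mul_nonneg (hW u (hS hu)) (hx.1.1 u (hS hu)).1) hne.symm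
    rw [← h1]
    have hpos : ∀ u ∈ S, 0 < W u * x u → 0 < W u ∧ 0 < x u := by
      intro u hu h
      have h2 := hW u (hS hu)
      have h3 := (hx.1.1 u (hS hu)).1
      exact ⟨pos_of_mul_pos_left h h3, pos_of_mul_pos_right h h2⟩
    calc ∑ u ∈ S with 0 < W u * x u, W u * x u ≤ ∑ u ∈ S with 0 < W u * x u, W u := by
          refine Finset.sum_le_sum fun u hu => ?_
          have hu' := hS (Finset.mem_filter.1 hu).1
          exact mul_le_of_le_one_right (hW u hu') (hx.1.1 u hu').2
      _ ≤ ∑ u ∈ D with q u, W u := by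
          refine Finset.sum_le_sum_of_subset_of_nonneg (fun u hu => ?_)
            (fun u hu _ => hWD u (Finset.mem_filter.1 hu).1)
          obtain ⟨hu, hwx⟩ := Finset.mem_filter.1 hu
          obtain ⟨hwu, hxu⟩ := hpos u hu hwx
          have hut : u ≠ t := by
            rintro rfl
            exact hxu.ne' hxt
          have hIcc := Finset.mem_Icc.1 (hS hu)
          refine Finset.mem_filter.2 ⟨hD u (Finset.mem_Ico.2 ⟨hIcc.1, by omega⟩) (hSJ u hu) ?_,
            hq u hu⟩
          by_contra! hlt
          exact hx.no_swap (hS hu) ht hwu hWt hxu (by rw [hxt]; exact one_pos) hlt (hSw u hu)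
  by_cases hwin :
      ∑ u ∈ Icc 1 t with P.window u = P.window t, W u * x u < a₁ * (P.ℓ / P.n) * P.k
  · right
    -- The main budget is now exhausted, and each window in J accounts for at most its inner bound.
    have h1 := hx.tight ht hWt hVt (by rw [hxt]; exact one_pos) hwin
    have h2 := Finset.sum_filter_add_sum_filter_not (Icc 1 t) (fun u => P.window u ∈ J)
      (fun u => W u * x u)
    have h3 : ∑ u ∈ Icc 1 t with P.window u ∈ J, W u * x u ≤
        #J * (a₁ * (P.ℓ / P.n) * P.k) := by
      rw [← Finset.sum_fiberwise_of_maps_to (g := P.window) (t := J)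
        (fun u hu => (Finset.mem_filter.1 hu).2), ← nsmul_eq_mul]
      refine Finset.sum_le_card_nsmul _ _ _ fun j hj => ?_
      refine le_trans (le_of_eq ?_) (hx.1.2.2 j)
      refine Finset.sum_congr ?_ fun _ _ => rfl
      ext u
      simp only [Finset.mem_filter]
      constructor
      · rintro ⟨⟨h, _⟩, h'⟩
        exact ⟨h, h'⟩
      · rintro ⟨h, h'⟩
        exact ⟨⟨h, h' ▸ hj⟩, h'⟩
    have h4 := hle {u ∈ Icc 1 t | P.window u ∉ J} (Finset.filter_subset _ _)
      (fun u hu => (Finset.mem_filter.1 hu).2) (fun _ _ => Or.inr hwin) (fun _ => True)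
      (fun _ _ => trivial)
    rw [Finset.filter_true] at h4
    linarith
  · left
    refine (not_lt.1 hwin).trans (hle _ (Finset.filter_subset _ _) ?_ ?_ _ ?_)
    · intro u hu
      rw [(Finset.mem_filter.1 hu).2]
      exact htJ
    · exact fun u hu => Or.inl (Finset.mem_filter.1 hu).2
    · exact fun u hu => (Finset.mem_filter.1 hu).2

theorem T_mem (X : ℕ → ℕ → ℝ) (t : ℕ) : T X t = 0 ∨ T X t = 1 := by
  unfold T
  split_ifs <;> simp

theorem F_mem (a₄ : ℝ) (W : ℕ → ℝ) (X : ℕ → ℕ → ℝ) (t : ℕ) :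
    P.F a₄ W X t = 0 ∨ P.F a₄ W X t = 1 := by
  unfold F
  split_ifs <;> simp

theorem algSel_nonneg (a₄ : ℝ) (W : ℕ → ℝ) (X : ℕ → ℕ → ℝ) (t : ℕ) :
    0 ≤ P.algSel a₄ W X t := by
  rw [algSel_eq]
  rcases T_mem X t with h | h <;> rcases P.F_mem a₄ W X t with h' | h' <;> simp [h, h']

theorem algSel_le_T (a₄ : ℝ) (W : ℕ → ℝ) (X : ℕ → ℕ → ℝ) (t : ℕ) :
    P.algSel a₄ W X t ≤ T X t := by
  rw [algSel_eq]
  rcases T_mem X t with h | h <;> rcases P.F_mem a₄ W X t with h' | h' <;> simp [h, h']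

/-- The outer constraints bound the total size selected in a window. -/
theorem sum_algSel_window_le {a₄ : ℝ} (ha₄ : 0 ≤ a₄ * (P.ℓ / P.n) * P.k) {W : ℕ → ℝ}
    (X : ℕ → ℕ → ℝ) (hW : ∀ u ∈ Icc 1 P.n, W u ≤ 1) (j : ℕ) {t : ℕ} (ht : t ≤ P.n + 1) :
    ∑ s ∈ Ico 1 t with P.window s = j, W s * P.algSel a₄ W X s ≤ a₄ * (P.ℓ / P.n) * P.k := by
  induction t with
  | zero => simpa using ha₄
  | succ t ih =>
    rcases Nat.eq_zero_or_pos t with rfl | htpos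
    · simpa using ha₄
    have ih := ih (by omega)
    rw [Finset.sum_filter] at ih ⊢
    rw [Finset.sum_Ico_succ_top (by omega)]
    rw [← Finset.sum_filter] at ih ⊢
    split_ifs with hj
    · have hWt := hW t (Finset.mem_Icc.2 ⟨htpos, by omega⟩)
      rw [algSel_eq]
      by_cases hF : ∑ s ∈ Ico 1 t with P.window s = P.window t, W s * P.algSel a₄ W X s
          ≤ a₄ * (P.ℓ / P.n) * P.k - 1 ∧
          ∑ s ∈ Ico 1 t, W s * P.algSel a₄ W X s ≤ P.k - 1
      · have h1 := hF.1
        rw [hj] at h1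
        have hF1 : P.F a₄ W X t = 1 := by
          unfold F
          rw [if_pos hF]
        rw [hF1]
        rcases T_mem X t with h | h <;> rw [h] <;> linarith
      · have hF0 : P.F a₄ W X t = 0 := by
          unfold F
          rw [if_neg hF]
        rw [hF0]
        linarith
    · linarith

end LinearProgram

/-! ### Elementary estimates for the parameters -/

section Parameters

variable (P : BARO)

/-- The size budget `ℓ k / n` that a window is entitled to. -/
noncomputable def windowBudget : ℝ := P.ℓ / P.n * P.k

theorem mul_windowBudget (a : ℝ) : a * (P.ℓ / P.n) * P.k = a * P.windowBudget := by
  rw [windowBudget, mul_assoc]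

theorem k_pos : 0 < P.k := by linarith [P.k_ge]

theorem n_ge : (160 : ℝ) ≤ P.n := by linarith [P.k_ge, P.k_le]

theorem n_pos : (0 : ℝ) < P.n := by linarith [P.n_ge]

theorem four_le_log_k : 4 ≤ Real.log P.k := by
  rw [Real.le_log_iff_exp_le P.k_pos]
  refine le_trans ?_ P.k_ge
  have h := Real.exp_one_lt_d9
  have h4 : Real.exp 4 = Real.exp 1 ^ 4 := by
    rw [← Real.exp_nat_mul]
    norm_num
  rw [h4]
  calc Real.exp 1 ^ 4 ≤ 2.7182818286 ^ 4 := pow_le_pow_left₀ (Real.exp_pos 1).le h.le 4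
    _ ≤ 80 := by norm_num

/-- Rounding moves ℓ by less than 1, and this is multiplied by k/n ≤ 1/2. -/
theorem abs_windowBudget_sub_log_le : |P.windowBudget - Real.log P.k| ≤ 1 / 2 := by
  have hn := P.n_pos
  have hk := P.k_pos
  have h : P.windowBudget - Real.log P.k =
      (P.k / P.n) * ((P.ℓ : ℝ) - P.n * Real.log P.k / P.k) := by
    rw [windowBudget]
    field_simp
  have hkn : P.k / P.n ≤ 1 / 2 := by
    rw [div_le_iff₀ hn]
    linarith [P.k_le]
  rw [h, abs_mul, abs_of_pos (div_pos hk hn)]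
  calc P.k / P.n * |(P.ℓ : ℝ) - P.n * Real.log P.k / P.k| ≤ 1 / 2 * 1 :=
        mul_le_mul hkn P.ℓ_round.le (abs_nonneg _) (by norm_num)
    _ = 1 / 2 := by norm_num

theorem log_sub_half_le_windowBudget : Real.log P.k - 1 / 2 ≤ P.windowBudget := by
  linarith [(abs_le.1 P.abs_windowBudget_sub_log_le).1]

theorem windowBudget_le : P.windowBudget ≤ Real.log P.k + 1 / 2 := by
  linarith [(abs_le.1 P.abs_windowBudget_sub_log_le).2]

theorem three_le_windowBudget : 3 ≤ P.windowBudget := by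
  linarith [P.log_sub_half_le_windowBudget, P.four_le_log_k]

theorem ℓ_pos : 0 < P.ℓ := by
  rcases Nat.eq_zero_or_pos P.ℓ with h | h
  · have := P.three_le_windowBudget
    rw [windowBudget, h] at this
    norm_num at this
  · exact h

theorem eight_le_Γ : (8 : ℝ) ≤ P.Γ := by
  refine le_trans ?_ P.Γ_ge
  refine Real.le_sqrt_of_sq_le ?_
  linarith [P.k_ge]

theorem k_le_Γ_sq : P.k ≤ (P.Γ : ℝ) ^ 2 :=
  (Real.sqrt_le_left (Nat.cast_nonneg _)).1 P.Γ_ge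

/-- `n / ℓ`, up to rounding the number of windows, is at most `k / 3`. -/
theorem n_le_k_mul_ℓ : 3 * (P.n : ℝ) ≤ P.k * P.ℓ := by
  have h := P.three_le_windowBudget
  rw [windowBudget, div_mul_eq_mul_div, le_div_iff₀ P.n_pos] at h
  linarith

theorem a₁_mul_nonneg : 0 ≤ a₁ * P.windowBudget := by
  have := P.three_le_windowBudget
  unfold a₁
  linarith

end Parameters

/-! ### Windows and free times -/

section Windows

variable (P : BARO)

theorem window_lt_iff {s : ℕ} (hs : 1 ≤ s) (j : ℕ) : P.window s < j ↔ s ≤ j * P.ℓ := by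
  rw [window, Nat.div_lt_iff_lt_mul P.ℓ_pos]
  omega

theorem card_filter_window_le {S : Finset ℕ} (hS : ∀ s ∈ S, 1 ≤ s) (j : ℕ) :
    #{s ∈ S | P.window s = j} ≤ P.ℓ := by
  calc #{s ∈ S | P.window s = j} ≤ #(Ioc (j * P.ℓ) ((j + 1) * P.ℓ)) := by
        refine Finset.card_le_card fun s hs => ?_
        obtain ⟨hs, hj⟩ := Finset.mem_filter.1 hs
        have h1 := P.window_lt_iff (hS s hs) j
        have h2 := P.window_lt_iff (hS s hs) (j + 1)
        rw [Finset.mem_Ioc]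
        constructor
        · by_contra h
          have := h1.2 (by omega)
          omega
        · exact h2.1 (by omega)
    _ = P.ℓ := by
        rw [Nat.card_Ioc, add_mul, one_mul]
        omega

theorem card_filter_adversarial_le {S : Finset ℕ} (hS : ∀ s ∈ S, 1 ≤ s) :
    #{s ∈ S | P.window s ∈ P.Wadv} ≤ P.Γ * P.ℓ := by
  have h := Finset.card_le_mul_card_image_of_maps_to (s := {s ∈ S | P.window s ∈ P.Wadv})
    (t := P.Wadv) (f := P.window) (fun s hs => (Finset.mem_filter.1 hs).2) P.ℓ
    (fun j _ => P.card_filter_window_le (fun s hs => hS s (Finset.mem_filter.1 hs).1) j)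
  calc _ ≤ P.ℓ * #P.Wadv := h
    _ ≤ P.ℓ * P.Γ := Nat.mul_le_mul_left _ P.card_Wadv
    _ = P.Γ * P.ℓ := mul_comm _ _

theorem n_le_card_RO_add : P.n ≤ #P.RO + P.Γ * P.ℓ := by
  have h1 : #(Icc 1 P.n \ P.RO) ≤ P.Γ * P.ℓ := by
    refine le_trans (Finset.card_le_card fun s hs => ?_)
      (P.card_filter_adversarial_le (S := Icc 1 P.n) fun s hs => (Finset.mem_Icc.1 hs).1)
    obtain ⟨hs, hs'⟩ := Finset.mem_sdiff.1 hs
    exact Finset.mem_filter.2 ⟨hs, P.adv_covered s hs hs'⟩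
  have h2 := Finset.card_sdiff_add_card_eq_card P.RO_subset
  rw [Nat.card_Icc] at h2
  omega

theorem card_RO_le : #P.RO ≤ P.n := by
  simpa using Finset.card_le_card P.RO_subset

theorem half_n_le_card_RO : (P.n : ℝ) / 2 ≤ #P.RO := by
  have h1 : (P.n : ℝ) ≤ #P.RO + P.Γ * P.ℓ := by exact_mod_cast P.n_le_card_RO_add
  have h2 := P.Γℓ_le
  rw [div_le_iff₀ P.n_pos] at h2
  linarith

theorem two_le_card_RO : 2 ≤ #P.RO := by
  have h1 := P.half_n_le_card_RO
  have h2 := P.n_ge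
  have h3 : (2 : ℝ) ≤ (#P.RO : ℝ) := by linarith
  exact_mod_cast h3

open Classical in
/-- The set of free times. -/
noncomputable def freeTimes : Finset ℕ := {s ∈ Icc 1 P.n | P.window s ∉ P.Wadv}

variable {P} in
theorem mem_freeTimes {s : ℕ} : s ∈ P.freeTimes ↔ P.IsFree s := by
  simp [freeTimes, IsFree]

theorem freeTimes_subset_RO : P.freeTimes ⊆ P.RO := fun _ hs =>
  (mem_freeTimes.1 hs).mem_RO

/-- All but `Γ` of the first `j` windows consist of free times. -/
theorem le_card_free_window_lt {j : ℕ} (hj : j * P.ℓ ≤ P.n) :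
    j * P.ℓ ≤ #{s ∈ P.freeTimes | P.window s < j} + P.Γ * P.ℓ := by
  have h1 := P.card_filter_adversarial_le (S := Icc 1 (j * P.ℓ))
    fun s hs => (Finset.mem_Icc.1 hs).1
  have h2 := Finset.card_filter_add_card_filter_not (s := Icc 1 (j * P.ℓ))
    (fun s => P.window s ∈ P.Wadv)
  have h3 : #{s ∈ Icc 1 (j * P.ℓ) | P.window s ∉ P.Wadv} ≤
      #{s ∈ P.freeTimes | P.window s < j} := by
    refine Finset.card_le_card fun s hs => ?_
    obtain ⟨hs, hs'⟩ := Finset.mem_filter.1 hs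
    obtain ⟨h1s, hsj⟩ := Finset.mem_Icc.1 hs
    exact Finset.mem_filter.2 ⟨mem_freeTimes.2 ⟨Finset.mem_Icc.2 ⟨h1s, hsj.trans hj⟩, hs'⟩,
      (P.window_lt_iff h1s j).2 hsj⟩
  rw [Nat.card_Icc] at h2
  omega

end Windows

/-! ### The densest items -/

section Densest

variable (P : BARO)

open Classical in
/-- The densest items of total size about `γ k`: those for which the strictly denser items have
total size less than `γ k`. -/
noncomputable def densest (γ : ℝ) : Finset (Fin #P.RO) :=
  {i | ∑ j with P.v i / P.w i < P.v j / P.w j, P.w j < γ * P.k}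

variable {P} in
theorem densest_upper {γ : ℝ} {i j : Fin #P.RO} (hi : i ∈ P.densest γ)
    (hij : P.v i / P.w i ≤ P.v j / P.w j) : j ∈ P.densest γ := by
  rw [densest, Finset.mem_filter] at hi ⊢
  refine ⟨Finset.mem_univ j, lt_of_le_of_lt ?_ hi.2⟩
  refine Finset.sum_le_sum_of_subset_of_nonneg (fun u hu => ?_) fun u _ _ => (P.w_pos u).le
  rw [Finset.mem_filter] at hu ⊢
  exact ⟨hu.1, hij.trans_lt hu.2⟩

/-- Consider the densest excluded item: the strictly denser ones have size at least γk and all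
belong to the set. If nothing is excluded, the assumption that all sizes add up to at least k
suffices. -/
theorem le_sum_densest {γ : ℝ} (hγ : γ ≤ 1) : γ * P.k ≤ ∑ i ∈ P.densest γ, P.w i := by
  by_cases h : ∃ i, i ∉ P.densest γ
  · obtain ⟨i, hi, hmax⟩ := Finset.exists_max_image (univ \ P.densest γ)
      (fun i => P.v i / P.w i) (by simpa [Finset.Nonempty] using h)
    simp only [Finset.mem_sdiff, Finset.mem_univ, true_and] at hi hmax
    have hi' := hi
    rw [densest, Finset.mem_filter] at hi'
    push Not at hi'
    refine (hi' (Finset.mem_univ i)).trans ?_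
    refine Finset.sum_le_sum_of_subset_of_nonneg (fun u hu => ?_) fun u _ _ => (P.w_pos u).le
    by_contra hu'
    exact absurd (Finset.mem_filter.1 hu).2 (not_lt.2 (hmax u hu'))
  · push Not at h
    rw [Finset.eq_univ_iff_forall.2 h]
    exact (mul_le_of_le_one_left P.k_pos.le hγ).trans P.k_le_sum_w

/-- Relative to the least dense member, all other members are strictly denser because densities are
distinct, so they have size below γk; that member adds at most 1. -/
theorem sum_densest_le {γ : ℝ} (hγ : 0 ≤ γ) : ∑ i ∈ P.densest γ, P.w i ≤ γ * P.k + 1 := by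
  rcases (P.densest γ).eq_empty_or_nonempty with h | h
  · rw [h, Finset.sum_empty]
    have := mul_nonneg hγ P.k_pos.le
    linarith
  · obtain ⟨i, hi, hmin⟩ := Finset.exists_min_image (P.densest γ) (fun i => P.v i / P.w i) h
    have hi' := hi
    rw [densest, Finset.mem_filter] at hi'
    rw [← Finset.sum_erase_add _ _ hi]
    have h1 : ∑ j ∈ (P.densest γ).erase i, P.w j ≤
        ∑ j with P.v i / P.w i < P.v j / P.w j, P.w j := by
      refine Finset.sum_le_sum_of_subset_of_nonneg (fun u hu => ?_) fun u _ _ => (P.w_pos u).le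
      obtain ⟨hui, hu⟩ := Finset.mem_erase.1 hu
      refine Finset.mem_filter.2 ⟨Finset.mem_univ u, lt_of_le_of_ne (hmin u hu) fun h => hui ?_⟩
      exact P.density_injective h.symm
    linarith [P.w_le_one i, hi'.2]

/-- Scale a competitor by γ, so that it uses size at most γk, and charge size at the price τ, the
smallest density in the set. At this price no item gains by deviating from the indicator of the set,
which itself has size at least γk. -/
theorem mul_OPT_le_sum_densest {γ : ℝ} (hγ : 0 < γ) (hγ1 : γ ≤ 1) :
    γ * P.OPT ≤ ∑ i ∈ P.densest γ, P.v i := by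
  have hsum := P.le_sum_densest hγ1
  have hne : (P.densest γ).Nonempty := by
    rw [Finset.nonempty_iff_ne_empty]
    intro h
    rw [h, Finset.sum_empty] at hsum
    linarith [mul_pos hγ P.k_pos]
  obtain ⟨m, hm, hmin⟩ := Finset.exists_min_image (P.densest γ) (fun i => P.v i / P.w i) hne
  set τ := P.v m / P.w m with hτ
  have hτ0 : 0 < τ := div_pos (P.v_pos m) (P.w_pos m)
  rw [mul_comm, ← le_div_iff₀ hγ]
  refine csSup_le ⟨0, fun _ => 0, by simp, by simpa using P.k_pos.le, by simp⟩ ?_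
  rintro y ⟨x, hx, hsize, rfl⟩
  rw [le_div_iff₀ hγ]
  have hpt : ∀ i, P.v i * (γ * x i) ≤ (if i ∈ P.densest γ then P.v i else 0) +
      τ * (P.w i * (γ * x i) - if i ∈ P.densest γ then P.w i else 0) := by
    intro i
    have hx0 : 0 ≤ γ * x i := mul_nonneg hγ.le (hx i).1
    have hx1 : γ * x i ≤ 1 := mul_le_one₀ hγ1 (hx i).1 (hx i).2
    have hv : P.v i = P.v i / P.w i * P.w i := (div_mul_cancel₀ _ (P.w_pos i).ne').symm
    have hw := P.w_pos i
    split_ifs with hi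
    · have h1 : τ * P.w i ≤ P.v i := by
        rw [hv]
        exact mul_le_mul_of_nonneg_right (hmin i hi) hw.le
      nlinarith [mul_nonneg (sub_nonneg.2 h1) (sub_nonneg.2 hx1)]
    · have h1 : P.v i ≤ τ * P.w i := by
        rw [hv]
        refine mul_le_mul_of_nonneg_right ?_ hw.le
        by_contra! h
        exact hi (densest_upper hm h.le)
      nlinarith [mul_le_mul_of_nonneg_right h1 hx0]
  have h := Finset.sum_le_sum fun i (_ : i ∈ univ) => hpt i
  rw [Finset.sum_add_distrib, ← Finset.mul_sum, Finset.sum_sub_distrib, Finset.sum_ite_mem,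
    Finset.sum_ite_mem, Finset.univ_inter] at h
  have h1 : ∑ i, P.v i * (γ * x i) = (∑ i, P.v i * x i) * γ := by
    rw [Finset.sum_mul]
    exact Finset.sum_congr rfl fun i _ => by ring
  have h2 : ∑ i, P.w i * (γ * x i) ≤ γ * P.k := by
    calc ∑ i, P.w i * (γ * x i) = γ * ∑ i, P.w i * x i := by
          rw [Finset.mul_sum]
          exact Finset.sum_congr rfl fun i _ => by ring
      _ ≤ γ * P.k := mul_le_mul_of_nonneg_left hsize hγ.le
  rw [h1] at h
  have h3 : τ * (∑ i, P.w i * (γ * x i) - ∑ i ∈ P.densest γ, P.w i) ≤ 0 :=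
    mul_nonpos_of_nonneg_of_nonpos hτ0.le (by linarith)
  linarith

open Classical in
/-- The size of an item if it is among the densest ones, and `0` otherwise. -/
noncomputable def denseSize (γ : ℝ) (i : Fin #P.RO) : ℝ := if i ∈ P.densest γ then P.w i else 0

theorem denseSize_mem (γ : ℝ) (i : Fin #P.RO) : P.denseSize γ i ∈ Set.Icc (0 : ℝ) 1 := by
  unfold denseSize
  split_ifs
  · exact ⟨(P.w_pos i).le, P.w_le_one i⟩
  · simp

theorem sum_denseSize (γ : ℝ) : ∑ i, P.denseSize γ i = ∑ i ∈ P.densest γ, P.w i := by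
  simp only [denseSize, Finset.sum_ite_mem, Finset.univ_inter]

open Classical in
/-- The size of the random-order item arriving at time `s` if it is among the densest ones, and
`0` otherwise. -/
noncomputable def denseSizeAt (γ : ℝ) (I : P.Arrival) (s : ℕ) : ℝ :=
  if h : s ∈ P.RO then P.denseSize γ (I ⟨s, h⟩) else 0

theorem denseSizeAt_nonneg (γ : ℝ) (I : P.Arrival) (s : ℕ) : 0 ≤ P.denseSizeAt γ I s := by
  unfold denseSizeAt
  split_ifs
  · exact (P.denseSize_mem γ _).1
  · exact le_rfl

end Densest

/-! ### Conditional probabilities -/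

section CondProb

variable {P : BARO}

theorem card_arrival_fixing_pos (t : P.RO) (i : Fin #P.RO) :
    0 < #{I : P.Arrival | I t = i} := by
  have h := card_mul_card_equiv_fixing (α := P.RO) t i
  have h0 : 0 < Fintype.card (P.RO ≃ Fin #P.RO) :=
    Fintype.card_pos_iff.2 ⟨P.RO.equivFin⟩
  rw [← h] at h0
  exact Nat.pos_of_mul_pos_left h0

open Classical in
theorem condProb_eq_sum (E : P.Arrival → Prop) (t : P.RO) (i : Fin #P.RO) :
    P.condProb E t i =
      (∑ I : P.Arrival with I t = i, if E I then (1 : ℝ) else 0) / #{I : P.Arrival | I t = i} := by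
  unfold condProb
  rw [← Finset.filter_filter, Finset.sum_boole]

/-- Markov's inequality. -/
theorem condProb_le_sum_div {E : P.Arrival → Prop} {t : P.RO} {i : Fin #P.RO} {φ : P.Arrival → ℝ}
    (hφ : ∀ I, 0 ≤ φ I) (h : ∀ I, I t = i → E I → 1 ≤ φ I) :
    P.condProb E t i ≤ (∑ I : P.Arrival with I t = i, φ I) / #{I : P.Arrival | I t = i} := by
  classical
  rw [condProb_eq_sum]
  refine div_le_div_of_nonneg_right (Finset.sum_le_sum fun I hI => ?_) (Nat.cast_nonneg _)
  split_ifs with hE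
  · exact h I (Finset.mem_filter.1 hI).2 hE
  · exact hφ I

theorem condProb_mono {E E' : P.Arrival → Prop} {t : P.RO} {i : Fin #P.RO}
    (h : ∀ I, I t = i → E I → E' I) : P.condProb E t i ≤ P.condProb E' t i := by
  classical
  rw [condProb_eq_sum E']
  refine condProb_le_sum_div (fun I => ?_) fun I hI hE => ?_
  · split_ifs <;> simp
  · rw [if_pos (h I hI hE)]

theorem condProb_le_one (E : P.Arrival → Prop) (t : P.RO) (i : Fin #P.RO) :
    P.condProb E t i ≤ 1 := by
  refine (condProb_le_sum_div (φ := fun _ => 1) (fun _ => zero_le_one)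
    fun _ _ _ => le_rfl).trans ?_
  have := card_arrival_fixing_pos t i
  simp [div_self_le_one]

theorem condProb_or_le (E E' : P.Arrival → Prop) (t : P.RO) (i : Fin #P.RO) :
    P.condProb (fun I => E I ∨ E' I) t i ≤ P.condProb E t i + P.condProb E' t i := by
  classical
  rw [condProb_eq_sum E, condProb_eq_sum E', ← add_div, ← Finset.sum_add_distrib]
  refine condProb_le_sum_div (fun I => ?_) fun I _ hE => ?_
  · positivity
  · rcases hE with hE | hE <;> rw [if_pos hE] <;> split_ifs <;> norm_num

theorem condProb_exists_le {κ : Type*} (J : Finset κ) (E : κ → P.Arrival → Prop) (t : P.RO)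
    (i : Fin #P.RO) :
    P.condProb (fun I => ∃ j ∈ J, E j I) t i ≤ ∑ j ∈ J, P.condProb (E j) t i := by
  classical
  simp only [condProb_eq_sum (E _)]
  rw [← Finset.sum_div, Finset.sum_comm]
  refine condProb_le_sum_div (fun I => ?_) fun I _ hE => ?_
  · positivity
  · obtain ⟨j, hj, hE⟩ := hE
    have := Finset.single_le_sum (f := fun j => if E j I then (1 : ℝ) else 0)
      (fun j _ => by positivity) hj
    simpa [hE] using this

/-- Chernoff's method, for the total size of the densest items arriving at a set of times. -/
theorem condProb_exp_le (γ : ℝ) (t : P.RO) (i : Fin #P.RO) {S : Finset ℕ} (hS : S ⊆ P.RO)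
    (htS : (t : ℕ) ∉ S) (r : ℝ) {E : P.Arrival → Prop} {a : ℝ}
    (hE : ∀ I, I t = i → E I → r * a ≤ r * ∑ s ∈ S, P.denseSizeAt γ I s) :
    P.condProb E t i ≤ Real.exp (#S / ((#P.RO : ℝ) - 1) *
      (∑ j ∈ P.densest γ, P.w j - P.denseSize γ i) * (Real.exp r - 1) - r * a) := by
  classical
  set S' : Finset P.RO := S.subtype (· ∈ P.RO) with hS'
  have hcard : #S' = #S := by
    rw [hS', Finset.card_subtype, Finset.filter_true_of_mem fun s hs => hS hs]
  have hsum : ∀ I : P.Arrival, ∑ s ∈ S, P.denseSizeAt γ I s =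
      ∑ s ∈ S', P.denseSize γ (I s) := by
    intro I
    rw [hS', ← Finset.sum_subtype_of_mem (P.denseSizeAt γ I) fun s hs => hS hs]
    refine Finset.sum_congr rfl fun s _ => ?_
    simp [denseSizeAt]
  have htS' : t ∉ S' := by simpa [hS'] using htS
  have hmgf := sum_exp_le_card_mul_exp (α := P.RO) t i (by simpa using P.two_le_card_RO)
    (P.denseSize γ) (by simp) (P.denseSize_mem γ) S' htS' r
  have hpos : (0 : ℝ) < #{I : P.Arrival | I t = i} := by
    exact_mod_cast card_arrival_fixing_pos t i
  -- Markov's inequality for exp(r(sum - a)); stating `hE` after multiplication by r covers upper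
  -- tails (r > 0) and lower tails (r < 0) at once.
  refine (condProb_le_sum_div
    (φ := fun I => Real.exp (r * ∑ s ∈ S', P.denseSize γ (I s)) * Real.exp (-(r * a)))
    (fun I => by positivity) fun I hI hEI => ?_).trans ?_
  · rw [← Real.exp_add, Real.one_le_exp_iff, ← hsum]
    linarith [hE I hI hEI]
  · rw [div_le_iff₀ hpos, ← Finset.sum_mul, sub_eq_add_neg, Real.exp_add]
    rw [hcard, sum_denseSize, Fintype.card_coe] at hmgf
    nlinarith [mul_le_mul_of_nonneg_right hmgf (Real.exp_pos (-(r * a))).le]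

/-- Upper tail with a large deviation. -/
theorem condProb_ge_le_exp_sub {γ : ℝ} (t : P.RO) (i : Fin #P.RO) {S : Finset ℕ} (hS : S ⊆ P.RO)
    (htS : (t : ℕ) ∉ S) {M a : ℝ}
    (hM : #S / ((#P.RO : ℝ) - 1) * ∑ j ∈ P.densest γ, P.w j ≤ M) :
    P.condProb (fun I => a ≤ ∑ s ∈ S, P.denseSizeAt γ I s) t i ≤ Real.exp (2 * M - a) := by
  refine (condProb_exp_le γ t i hS htS 1 (a := a) fun I _ h => by simpa using h).trans ?_
  rw [Real.exp_le_exp]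
  have hN : (2 : ℝ) ≤ #P.RO := by exact_mod_cast P.two_le_card_RO
  have hq : (0 : ℝ) ≤ #S / ((#P.RO : ℝ) - 1) := div_nonneg (Nat.cast_nonneg _) (by linarith)
  have h1 := mul_nonneg hq (P.denseSize_mem γ i).1
  have he : Real.exp 1 - 1 ≤ 2 := by linarith [Real.exp_one_lt_d9]
  have he0 : 0 ≤ Real.exp 1 - 1 := by linarith [Real.add_one_le_exp (1 : ℝ)]
  have hM0 : 0 ≤ M := le_trans (mul_nonneg hq (Finset.sum_nonneg fun j _ => (P.w_pos j).le)) hM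
  have h2 : #S / ((#P.RO : ℝ) - 1) * (∑ j ∈ P.densest γ, P.w j - P.denseSize γ i) ≤ M := by
    rw [mul_sub]
    linarith
  nlinarith [mul_le_mul_of_nonneg_right h2 he0, mul_le_mul_of_nonneg_left he hM0]

/-- Upper tail with a moderate deviation. -/
theorem condProb_ge_le_exp_sq {γ : ℝ} (t : P.RO) (i : Fin #P.RO) {S : Finset ℕ} (hS : S ⊆ P.RO)
    (htS : (t : ℕ) ∉ S) {M K D : ℝ} (hK : 0 < K) (hMK : M ≤ K) (hD : 0 ≤ D) (hDK : D ≤ 2 * K)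
    (hM : #S / ((#P.RO : ℝ) - 1) * ∑ j ∈ P.densest γ, P.w j ≤ M) :
    P.condProb (fun I => M + D ≤ ∑ s ∈ S, P.denseSizeAt γ I s) t i ≤
      Real.exp (-(D ^ 2 / (4 * K))) := by
  -- The minimizer of K·r² - r·D, the exponent obtained from exp r - 1 ≤ r + r².
  set r := D / (2 * K) with hr
  have hr0 : 0 ≤ r := by positivity
  have hr1 : r ≤ 1 := by rwa [hr, div_le_one (by positivity)]
  refine (condProb_exp_le γ t i hS htS r (a := M + D) fun I _ h =>
    mul_le_mul_of_nonneg_left h hr0).trans ?_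
  rw [Real.exp_le_exp]
  have hN : (2 : ℝ) ≤ #P.RO := by exact_mod_cast P.two_le_card_RO
  have hq : (0 : ℝ) ≤ #S / ((#P.RO : ℝ) - 1) := div_nonneg (Nat.cast_nonneg _) (by linarith)
  have h1 := mul_nonneg hq (P.denseSize_mem γ i).1
  have he : Real.exp r - 1 ≤ r + r ^ 2 := by
    have h := Real.abs_exp_sub_one_sub_id_le (x := r) (by rwa [abs_of_nonneg hr0])
    linarith [(abs_le.1 h).2]
  have he0 : 0 ≤ Real.exp r - 1 := by linarith [Real.add_one_le_exp r]
  have hM0 : 0 ≤ M := le_trans (mul_nonneg hq (Finset.sum_nonneg fun j _ => (P.w_pos j).le)) hM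
  have h2 : #S / ((#P.RO : ℝ) - 1) * (∑ j ∈ P.densest γ, P.w j - P.denseSize γ i) ≤ M := by
    rw [mul_sub]
    linarith
  have h3 := mul_le_mul_of_nonneg_right h2 he0
  have h4 := mul_le_mul_of_nonneg_left he hM0
  have h5 := mul_le_mul_of_nonneg_right hMK (sq_nonneg r)
  have h6 : K * r ^ 2 - r * D = -(D ^ 2 / (4 * K)) := by
    rw [hr]
    field_simp
    ring
  nlinarith

/-- Lower tail. -/
theorem condProb_le_le_exp_sq {γ : ℝ} (t : P.RO) (i : Fin #P.RO) {S : Finset ℕ} (hS : S ⊆ P.RO)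
    (htS : (t : ℕ) ∉ S) {M K a : ℝ} (hK : 0 < K) (hM0 : 0 ≤ M) (hMK : M ≤ K) (ha : a ≤ M)
    (hM : M ≤ #S / ((#P.RO : ℝ) - 1) * (∑ j ∈ P.densest γ, P.w j - 1)) :
    P.condProb (fun I => ∑ s ∈ S, P.denseSizeAt γ I s ≤ a) t i ≤
      Real.exp (-((M - a) ^ 2 / (2 * K))) := by
  -- The minimizer of K·r²/2 - r(M - a).
  set r := (M - a) / K with hr
  have hr0 : 0 ≤ r := div_nonneg (by linarith) hK.le
  refine (condProb_exp_le γ t i hS htS (-r) (a := a) fun I _ h =>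
    mul_le_mul_of_nonpos_left h (by linarith)).trans ?_
  rw [Real.exp_le_exp]
  have hN : (2 : ℝ) ≤ #P.RO := by exact_mod_cast P.two_le_card_RO
  have hq : (0 : ℝ) ≤ #S / ((#P.RO : ℝ) - 1) := div_nonneg (Nat.cast_nonneg _) (by linarith)
  have he : Real.exp (-r) - 1 ≤ -r + r ^ 2 / 2 := by
    have h := Real.quadratic_le_exp_of_nonneg hr0
    have h0 : 0 < Real.exp (-r) := Real.exp_pos _
    have h1 : Real.exp (-r) * Real.exp r = 1 := by rw [← Real.exp_add]; simp
    have h2 : (1 - r + r ^ 2 / 2) * (1 + r + r ^ 2 / 2) = 1 + r ^ 4 / 4 := by ring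
    have h3 : 0 < 1 + r + r ^ 2 / 2 := by positivity
    have h4 : Real.exp (-r) * (1 + r + r ^ 2 / 2) ≤ (1 - r + r ^ 2 / 2) * (1 + r + r ^ 2 / 2) := by
      rw [h2]
      have := mul_le_mul_of_nonneg_left h h0.le
      have : 0 ≤ r ^ 4 := by positivity
      linarith
    linarith [le_of_mul_le_mul_right h4 h3]
  have he0 : Real.exp (-r) - 1 ≤ 0 := by
    rw [sub_nonpos, Real.exp_le_one_iff]
    linarith
  -- The 1 subtracted in `hM` pays for item i, which is fixed at t and unavailable to S.
  have h2 : M ≤ #S / ((#P.RO : ℝ) - 1) * (∑ j ∈ P.densest γ, P.w j - P.denseSize γ i) :=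
    hM.trans (mul_le_mul_of_nonneg_left (by linarith [(P.denseSize_mem γ i).2]) hq)
  have h3 := mul_le_mul_of_nonpos_right h2 he0
  have h4 := mul_le_mul_of_nonneg_left he hM0
  have h5 := mul_le_mul_of_nonneg_right hMK (sq_nonneg r)
  have h6 : K * r ^ 2 / 2 - r * (M - a) = -((M - a) ^ 2 / (2 * K)) := by
    rw [hr]
    field_simp
    ring
  nlinarith

end CondProb

/-! ### Concentration of the total size of the densest items -/

section Concentration

variable {P : BARO}

/-- Equivalent to #S + 1 ≤ #RO, which holds because t is a further random-order time outside S. -/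
theorem card_div_le_succ_div (t : P.RO) {S : Finset ℕ} (hS : S ⊆ P.RO) (htS : (t : ℕ) ∉ S) :
    (#S : ℝ) / ((#P.RO : ℝ) - 1) ≤ ((#S : ℝ) + 1) / #P.RO := by
  have hN : (2 : ℝ) ≤ #P.RO := by exact_mod_cast P.two_le_card_RO
  have hlt : #S + 1 ≤ #P.RO := by
    rw [← Finset.card_insert_of_notMem htS]
    exact Finset.card_le_card (Finset.insert_subset t.2 hS)
  have hlt' : (#S : ℝ) + 1 ≤ #P.RO := by exact_mod_cast hlt
  rw [div_le_div_iff₀ (by linarith) (by linarith)]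
  nlinarith

/-- With u = Γℓ/n ≤ 1/2, at least (1 - u)n times are random-order, and (1 - u)(1 + 2u) ≥ 1. -/
theorem div_card_RO_le {r : ℝ} (hr : 0 ≤ r) :
    r / #P.RO ≤ r / P.n * (1 + 2 * (P.Γ * P.ℓ / P.n)) := by
  have hn := P.n_pos
  have hN : (0 : ℝ) < #P.RO := by linarith [P.half_n_le_card_RO]
  have h1 : (P.n : ℝ) ≤ #P.RO + P.Γ * P.ℓ := by exact_mod_cast P.n_le_card_RO_add
  have h2 := P.Γℓ_le
  set u : ℝ := P.Γ * P.ℓ / P.n with hu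
  have hu0 : 0 ≤ u := by positivity
  have h3 : (P.Γ : ℝ) * P.ℓ = u * P.n := by
    rw [hu]
    field_simp
  rw [h3] at h1
  rw [div_mul_eq_mul_div, div_le_div_iff₀ hN hn, mul_assoc]
  refine mul_le_mul_of_nonneg_left ?_ hr
  have h4 := mul_le_mul_of_nonneg_left h1 (by linarith : 0 ≤ 1 + 2 * u)
  nlinarith [mul_nonneg (mul_nonneg hu0 (by linarith : 0 ≤ 1 - 2 * u)) hn.le]

/-- The term 2ΓB accounts for the times missing from RO, and the final 2 for the item by which
`densest γ` may exceed size γk. -/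
theorem mean_le {γ : ℝ} (hγ : 0 ≤ γ) (hγ1 : γ ≤ 1) (t : P.RO) {S : Finset ℕ} (hS : S ⊆ P.RO)
    (htS : (t : ℕ) ∉ S) (hcard : #S + 1 ≤ (t : ℕ)) :
    #S / ((#P.RO : ℝ) - 1) * ∑ j ∈ P.densest γ, P.w j ≤
      γ * (t / P.n * P.k) + 2 * (P.Γ * P.windowBudget) + 2 := by
  have hn := P.n_pos
  have hk := P.k_pos
  have hN : (0 : ℝ) < #P.RO := by linarith [P.half_n_le_card_RO]
  have htn : ((t : ℕ) : ℝ) / P.n ≤ 1 := by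
    rw [div_le_one hn]
    exact_mod_cast (Finset.mem_Icc.1 (P.RO_subset t.2)).2
  have ht0 : (0 : ℝ) ≤ ((t : ℕ) : ℝ) / P.n := by positivity
  have h1 : (#S : ℝ) / ((#P.RO : ℝ) - 1) ≤ t / P.n * (1 + 2 * (P.Γ * P.ℓ / P.n)) := by
    refine (card_div_le_succ_div t hS htS).trans
      (le_trans ?_ (div_card_RO_le (Nat.cast_nonneg _)))
    refine div_le_div_of_nonneg_right ?_ hN.le
    exact_mod_cast hcard
  have h2 := P.sum_densest_le hγ
  have hL : (P.Γ : ℝ) * P.windowBudget = P.Γ * P.ℓ / P.n * P.k := by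
    rw [windowBudget]
    ring
  have hu := P.Γℓ_le
  have hu0 : (0 : ℝ) ≤ P.Γ * P.ℓ / P.n := by positivity
  rw [hL]
  set u : ℝ := P.Γ * P.ℓ / P.n
  set q : ℝ := ((t : ℕ) : ℝ) / P.n
  calc _ ≤ q * (1 + 2 * u) * (γ * P.k + 1) :=
        mul_le_mul h1 h2 (Finset.sum_nonneg fun j _ => (P.w_pos j).le) (by positivity)
    _ = γ * (q * P.k) + 2 * ((q * γ) * (u * P.k)) + q * (1 + 2 * u) := by ring
    _ ≤ γ * (q * P.k) + 2 * (1 * (u * P.k)) + 1 * 2 := by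
        gcongr
        · exact mul_le_one₀ htn hγ hγ1
        · linarith
    _ = _ := by ring

theorem exp_neg_mul_log_k (m : ℕ) : Real.exp (-(m * Real.log P.k)) = 1 / P.k ^ m := by
  rw [Real.exp_neg, Real.exp_nat_mul, Real.exp_log P.k_pos, one_div]

/-- A window hardly ever violates its inner constraint by dense items alone. -/
theorem condProb_window_le {γ : ℝ} (hγ : 0 ≤ γ) (hγ1 : γ ≤ 1) (t : P.RO) (i : Fin #P.RO)
    {S : Finset ℕ} (hS : S ⊆ P.RO) (htS : (t : ℕ) ∉ S) (hcard : #S ≤ P.ℓ) :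
    P.condProb (fun I => a₁ * P.windowBudget ≤ ∑ s ∈ S, P.denseSizeAt γ I s) t i ≤
      1 / P.k ^ 2 := by
  have hn := P.n_ge
  have hk := P.k_ge
  have hN := P.half_n_le_card_RO
  have hmean : #S / ((#P.RO : ℝ) - 1) * ∑ j ∈ P.densest γ, P.w j ≤ 3 * P.windowBudget := by
    have h1 : (#S : ℝ) / ((#P.RO : ℝ) - 1) ≤ P.ℓ / ((P.n : ℝ) / 2 - 1) := by
      have : (#S : ℝ) ≤ P.ℓ := by exact_mod_cast hcard
      exact div_le_div₀ (Nat.cast_nonneg _) this (by linarith) (by linarith)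
    have h2 : ∑ j ∈ P.densest γ, P.w j ≤ P.k + 1 := by
      have := P.sum_densest_le hγ
      nlinarith [mul_le_of_le_one_left P.k_pos.le hγ1]
    calc _ ≤ P.ℓ / ((P.n : ℝ) / 2 - 1) * (P.k + 1) :=
          mul_le_mul h1 h2 (Finset.sum_nonneg fun j _ => (P.w_pos j).le)
            (div_nonneg (Nat.cast_nonneg _) (by linarith))
      _ ≤ 3 * P.windowBudget := by
          have h3 : (P.k + 1) / ((P.n : ℝ) / 2 - 1) ≤ 3 * P.k / P.n := by
            rw [div_le_div_iff₀ (by linarith) (by linarith)]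
            nlinarith
          have h4 := mul_le_mul_of_nonneg_left h3 (Nat.cast_nonneg (α := ℝ) P.ℓ)
          calc _ = (P.ℓ : ℝ) * ((P.k + 1) / ((P.n : ℝ) / 2 - 1)) := by ring
            _ ≤ _ := h4
            _ = _ := by
              rw [windowBudget]
              ring
  -- The exponent is (6 - 601)B, far below -2 ln k.
  refine (condProb_ge_le_exp_sub t i hS htS hmean).trans ?_
  rw [← exp_neg_mul_log_k, Real.exp_le_exp]
  have := P.log_sub_half_le_windowBudget
  have := P.four_le_log_k
  unfold a₁
  push_cast
  linarith

/-- The first `j` windows hardly ever contain too few of the densest items. -/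
theorem condProb_prefix_le (t : P.RO) (i : Fin #P.RO) {j : ℕ} (hj : 3 * P.Γ ≤ j)
    (hjt : j ≤ P.window t) :
    P.condProb (fun I => ∑ s ∈ P.freeTimes with P.window s < j, P.denseSizeAt 1 I s ≤
      ((j : ℝ) + 1 - 4 * P.Γ) * P.windowBudget) t i ≤ 1 / P.k ^ 2 := by
  obtain ⟨ht1, htn⟩ := Finset.mem_Icc.1 (P.RO_subset t.2)
  have hjn : j * P.ℓ ≤ P.n := by
    by_contra! h
    have := (P.window_lt_iff ht1 j).2 (by omega)
    omega
  have hn := P.n_ge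
  have hk := P.k_ge
  have hΓ := P.eight_le_Γ
  have hL := P.three_le_windowBudget
  have hlog := P.four_le_log_k
  have hLlog := P.log_sub_half_le_windowBudget
  have hj' : 3 * (P.Γ : ℝ) ≤ j := by exact_mod_cast hj
  have hjn' : (j : ℝ) * P.ℓ ≤ P.n := by exact_mod_cast hjn
  have hjL : (j : ℝ) * P.windowBudget = j * P.ℓ / P.n * P.k := by
    rw [windowBudget]
    ring
  have hjk : (j : ℝ) * P.windowBudget ≤ P.k := by
    rw [hjL]
    refine mul_le_of_le_one_left P.k_pos.le ?_
    rwa [div_le_one P.n_pos]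
  have hcard := P.le_card_free_window_lt hjn
  set S := {s ∈ P.freeTimes | P.window s < j} with hSdef
  have hcard' : ((j : ℝ) - P.Γ) * P.ℓ ≤ #S := by
    have : (j : ℝ) * P.ℓ ≤ #S + P.Γ * P.ℓ := by exact_mod_cast hcard
    linarith
  have hS : S ⊆ P.RO := (Finset.filter_subset _ _).trans P.freeTimes_subset_RO
  have htS : (t : ℕ) ∉ S := by
    intro h
    have := (Finset.mem_filter.1 h).2
    omega
  have hN : (#P.RO : ℝ) ≤ P.n := by exact_mod_cast P.card_RO_le
  have hN2 := P.half_n_le_card_RO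
  -- At least j - Γ of the first j windows are free, each expecting about B; the 1 absorbs
  -- conditioning on item i.
  set M := ((j : ℝ) - P.Γ) * P.windowBudget - 1 with hM
  have hM0 : 0 ≤ M := by nlinarith
  have hMk : M ≤ P.k := by nlinarith
  have hmean : M ≤ #S / ((#P.RO : ℝ) - 1) * (∑ i ∈ P.densest 1, P.w i - 1) := by
    have h1 : ((j : ℝ) - P.Γ) * P.ℓ / P.n ≤ #S / ((#P.RO : ℝ) - 1) :=
      div_le_div₀ (Nat.cast_nonneg _) hcard' (by linarith) (by linarith)
    have h2 := P.le_sum_densest le_rfl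
    have h3 : ((j : ℝ) - P.Γ) * P.ℓ / P.n ≤ 1 := by
      rw [div_le_one P.n_pos]
      nlinarith [Nat.cast_nonneg (α := ℝ) P.ℓ]
    calc M = ((j : ℝ) - P.Γ) * P.ℓ / P.n * P.k - 1 := by
          rw [hM, windowBudget]
          ring
      _ ≤ ((j : ℝ) - P.Γ) * P.ℓ / P.n * (P.k - 1) := by linarith
      _ ≤ _ := by
          refine mul_le_mul h1 (by linarith) (by linarith) ?_
          exact div_nonneg (Nat.cast_nonneg _) (by linarith)
  have hgap : 2 * (P.Γ * P.windowBudget) ≤ M - ((j : ℝ) + 1 - 4 * P.Γ) * P.windowBudget := by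
    nlinarith
  refine (condProb_le_le_exp_sq t i hS htS P.k_pos hM0 hMk (by nlinarith) hmean).trans ?_
  rw [← exp_neg_mul_log_k, Real.exp_le_exp, neg_le_neg_iff, le_div_iff₀ (by linarith)]
  -- This is where Γ ≥ √k enters: the squared gap is at least 4Γ²B² ≥ 4k ln k, as the exponent 2 ln
  -- k requires.
  have h1 : (2 * (P.Γ * P.windowBudget)) ^ 2 ≤
      (M - ((j : ℝ) + 1 - 4 * P.Γ) * P.windowBudget) ^ 2 :=
    pow_le_pow_left₀ (by positivity) hgap 2
  refine le_trans ?_ h1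
  have h2 : Real.log P.k ≤ P.windowBudget ^ 2 := by nlinarith
  have h3 := mul_le_mul P.k_le_Γ_sq h2 (by linarith) (sq_nonneg _)
  push_cast
  nlinarith

end Concentration

/-! ### Tentative selections and blocking -/

section Blocking

variable {P : BARO}

/-- The arrival order is typical before time `t`: in every window the densest items of total size
about `k` obey the inner constraint, and sufficiently long initial segments contain many of them. -/
def Typical (P : BARO) (t : ℕ) (I : P.Arrival) : Prop :=
  ∀ j ≤ P.window t,
    ∑ s ∈ (P.freeTimes.erase t) with P.window s = j, P.denseSizeAt 1 I s ≤ a₁ * P.windowBudget ∧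
    (3 * P.Γ ≤ j → ((j : ℝ) + 1 - 4 * P.Γ) * P.windowBudget <
      ∑ s ∈ P.freeTimes with P.window s < j, P.denseSizeAt 1 I s)

/-- Union bound over at most k windows, with two exceptional events of probability at most 1/k² for
each. -/
theorem condProb_not_typical_le (t : P.RO) (i : Fin #P.RO) :
    P.condProb (fun I => ¬ P.Typical t I) t i ≤ 2 / P.k := by
  have hk := P.k_ge
  obtain ⟨ht1, htn⟩ := Finset.mem_Icc.1 (P.RO_subset t.2)
  have hcount : ((#(range (P.window t + 1)) : ℕ) : ℝ) ≤ P.k := by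
    have h1 : P.window t * P.ℓ ≤ P.n := by
      have := Nat.div_mul_le_self ((t : ℕ) - 1) P.ℓ
      rw [window]
      omega
    have h2 : (P.window t : ℝ) * P.ℓ ≤ P.n := by exact_mod_cast h1
    have h3 := P.n_le_k_mul_ℓ
    have hℓ : (0 : ℝ) < P.ℓ := by exact_mod_cast P.ℓ_pos
    have h4 : 3 * (P.window t : ℝ) ≤ P.k := by
      by_contra! h
      nlinarith [mul_lt_mul_of_pos_right h hℓ]
    rw [Finset.card_range]
    push_cast
    linarith
  have hsub : ∀ j, {s ∈ P.freeTimes.erase t | P.window s = j} ⊆ P.RO := fun j =>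
    (Finset.filter_subset _ _).trans ((Finset.erase_subset _ _).trans P.freeTimes_subset_RO)
  have hj : ∀ j ∈ range (P.window t + 1),
      P.condProb (fun I => a₁ * P.windowBudget ≤
          ∑ s ∈ (P.freeTimes.erase t) with P.window s = j, P.denseSizeAt 1 I s ∨
        (3 * P.Γ ≤ j ∧ ∑ s ∈ P.freeTimes with P.window s < j, P.denseSizeAt 1 I s ≤
          ((j : ℝ) + 1 - 4 * P.Γ) * P.windowBudget)) t i ≤ 2 / P.k ^ 2 := by
    intro j hj
    have h1 := condProb_window_le zero_le_one le_rfl t i (hsub j) (by simp)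
      (P.card_filter_window_le (fun s hs =>
        (Finset.mem_Icc.1 (P.RO_subset (P.freeTimes_subset_RO (Finset.mem_of_mem_erase hs)))).1) j)
    have h2 : P.condProb (fun I => 3 * P.Γ ≤ j ∧
        ∑ s ∈ P.freeTimes with P.window s < j, P.denseSizeAt 1 I s ≤
          ((j : ℝ) + 1 - 4 * P.Γ) * P.windowBudget) t i ≤ 1 / P.k ^ 2 := by
      by_cases h : 3 * P.Γ ≤ j
      · exact (condProb_mono fun I _ hI => hI.2).trans
          (condProb_prefix_le t i h (by simpa [Nat.lt_succ_iff] using hj))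
      · refine (condProb_le_sum_div (φ := fun _ => 0) (fun _ => le_rfl)
          fun I _ hI => absurd hI.1 h).trans ?_
        simpa using sq_nonneg P.k
    refine (condProb_or_le _ _ t i).trans ?_
    have h3 : 2 / P.k ^ 2 = 1 / P.k ^ 2 + 1 / P.k ^ 2 := by ring
    rw [h3]
    exact add_le_add h1 h2
  calc P.condProb (fun I => ¬ P.Typical t I) t i
      ≤ P.condProb (fun I => ∃ j ∈ range (P.window t + 1), (a₁ * P.windowBudget ≤
          ∑ s ∈ (P.freeTimes.erase t) with P.window s = j, P.denseSizeAt 1 I s ∨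
        (3 * P.Γ ≤ j ∧ ∑ s ∈ P.freeTimes with P.window s < j, P.denseSizeAt 1 I s ≤
          ((j : ℝ) + 1 - 4 * P.Γ) * P.windowBudget))) t i := by
        refine condProb_mono fun I _ hI => ?_
        by_contra! hcon
        refine hI fun j hj => ?_
        have h := hcon j (Finset.mem_range.2 (by omega))
        exact ⟨h.1.le, h.2⟩
    _ ≤ ∑ j ∈ range (P.window t + 1), 2 / P.k ^ 2 :=
        (condProb_exists_le _ _ t i).trans (Finset.sum_le_sum hj)
    _ ≤ 2 / P.k := by
        rw [Finset.sum_const, nsmul_eq_mul, pow_two, ← div_div, mul_div_assoc',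
          div_le_iff₀ P.k_pos, mul_comm]
        exact mul_le_mul_of_nonneg_left hcount (by positivity)

/-- `IsLPChoice` says something only where the program is feasible; this is the witness of
feasibility once c_s ≥ 0. -/
theorem lpFeasible_zero (W : ℕ → ℝ) {s : ℕ} (hs1 : 1 ≤ s)
    (hs : 4 * (P.Γ : ℝ) * P.ℓ ≤ s) : P.LPFeasible W s (fun _ => 0) := by
  have hspos : (0 : ℝ) < s := by exact_mod_cast hs1
  refine ⟨fun _ _ => by simp, ?_, fun j => ?_⟩
  · have hc : 0 ≤ P.c s := by
      rw [c, sub_nonneg, div_le_one hspos]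
      exact hs
    have := P.k_pos
    simp only [mul_zero, Finset.sum_const_zero]
    positivity
  · simpa [mul_windowBudget] using P.a₁_mul_nonneg

theorem c_mul_eq {s : ℕ} (hs1 : 1 ≤ s) :
    P.c s * (s / P.n) * P.k = s / P.n * P.k - 4 * (P.Γ * P.windowBudget) := by
  have hspos : (s : ℝ) ≠ 0 := by positivity
  have hn := P.n_pos.ne'
  rw [c, windowBudget]
  field_simp

theorem Adversary.W_free (A : P.Adversary) (I : P.Arrival) {s : ℕ} (hs : P.IsFree s) :
    A.W I s = P.w (I ⟨s, hs.mem_RO⟩) := A.W_RO I ⟨s, hs.mem_RO⟩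

theorem Adversary.V_free (A : P.Adversary) (I : P.Arrival) {s : ℕ} (hs : P.IsFree s) :
    A.V I s = P.v (I ⟨s, hs.mem_RO⟩) := A.V_RO I ⟨s, hs.mem_RO⟩

theorem denseSizeAt_free {γ : ℝ} {I : P.Arrival} {s : ℕ} (hs : P.IsFree s) :
    P.denseSizeAt γ I s = P.denseSize γ (I ⟨s, hs.mem_RO⟩) := by
  rw [denseSizeAt, dif_pos hs.mem_RO]

theorem denseSize_pos_iff {γ : ℝ} {i : Fin #P.RO} :
    0 < P.denseSize γ i ↔ i ∈ P.densest γ := by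
  unfold denseSize
  split_ifs with h <;> simp [h, P.w_pos]

theorem Adversary.W_eq_denseSizeAt (A : P.Adversary) {γ : ℝ} {I : P.Arrival} {s : ℕ}
    (hs : P.IsFree s) (h : 0 < P.denseSizeAt γ I s) : A.W I s = P.denseSizeAt γ I s := by
  rw [denseSizeAt_free hs] at h ⊢
  rw [A.W_free I hs, denseSize, if_pos (denseSize_pos_iff.1 h)]

theorem window_mono {s t : ℕ} (h : s ≤ t) : P.window s ≤ P.window t :=
  Nat.div_le_div_right (Nat.sub_le_sub_right h 1)

/-- In a typical arrival order only the densest items are tentatively selected. -/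
theorem Typical.mem_densest {t : ℕ} {I : P.Arrival} (hI : P.Typical t I) {A : P.Adversary}
    {X : P.Arrival → ℕ → ℕ → ℝ} (hX : P.IsLPChoice A X) {s : ℕ} (hs : P.IsFree s) (hst : s < t)
    (hs4 : 4 * (P.Γ : ℝ) * P.ℓ ≤ s) (hpick : 0 < X I s s) :
    I ⟨s, hs.mem_RO⟩ ∈ P.densest 1 := by
  classical
  by_contra hnot
  obtain ⟨hs1, hsn⟩ := Finset.mem_Icc.1 hs.1
  have hopt := hX I s hs.1 ⟨_, lpFeasible_zero _ hs1 hs4⟩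
  -- All these items are strictly denser than the one picked at s, so they must fit into the budget
  -- of LP_s. That budget is at most (j + 1 - 4Γ)B with j the window of s, contradicting typicality.
  set D : Finset ℕ := {u ∈ P.freeTimes | u ≤ s ∧ 0 < P.denseSizeAt 1 I u} with hDdef
  have hDmem : ∀ u ∈ D, P.IsFree u ∧ u ≤ s ∧ 0 < P.denseSizeAt 1 I u := by
    intro u hu
    obtain ⟨h1, h2⟩ := Finset.mem_filter.1 hu
    exact ⟨mem_freeTimes.1 h1, h2⟩
  have hDW : ∀ u ∈ D, A.W I u = P.denseSizeAt 1 I u := fun u hu =>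
    A.W_eq_denseSizeAt (hDmem u hu).1 (hDmem u hu).2.2
  have hle : ∑ u ∈ D, A.W I u ≤ P.c s * (s / P.n) * P.k := by
    refine hopt.sum_denser_le (Finset.mem_Icc.2 ⟨hs1, le_rfl⟩) ?_ ?_ hpick ?_ ?_ ?_ ?_
    · intro u hu
      obtain ⟨h1, h2⟩ := Finset.mem_Icc.1 hu
      exact (A.W_mem I u (Finset.mem_Icc.2 ⟨h1, h2.trans hsn⟩)).1
    · rw [A.W_free I hs]
      exact P.w_pos _
    · intro u hu
      obtain ⟨h1, h2, _⟩ := hDmem u hu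
      exact Finset.mem_Icc.2 ⟨(Finset.mem_Icc.1 h1.1).1, h2⟩
    · intro u hu
      rw [hDW u hu]
      exact (hDmem u hu).2.2
    · intro u hu
      obtain ⟨h1, _, h3⟩ := hDmem u hu
      rw [A.W_free I hs, A.V_free I hs, A.W_free I h1, A.V_free I h1,
        ← div_lt_div_iff₀ (P.w_pos _) (P.w_pos _)]
      rw [denseSizeAt_free h1, denseSize_pos_iff] at h3
      by_contra! h
      exact hnot (densest_upper h3 h)
    · intro j
      rw [mul_windowBudget]
      rcases Finset.eq_empty_or_nonempty {u ∈ D | P.window u = j} with h | ⟨u, hu⟩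
      · rw [h, Finset.sum_empty]
        exact P.a₁_mul_nonneg
      · obtain ⟨huD, rfl⟩ := Finset.mem_filter.1 hu
        have hut : P.window u ≤ P.window t := window_mono ((hDmem u huD).2.1.trans hst.le)
        refine le_trans ?_ (hI _ hut).1
        rw [Finset.sum_congr rfl fun v hv => hDW v (Finset.mem_filter.1 hv).1]
        refine Finset.sum_le_sum_of_subset_of_nonneg (Finset.filter_subset_filter _ fun v hv => ?_)
          fun v _ _ => P.denseSizeAt_nonneg 1 I v
        have := (hDmem v hv).2.1
        exact Finset.mem_erase.2 ⟨by omega, mem_freeTimes.2 (hDmem v hv).1⟩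
  have hsj : s ≤ (P.window s + 1) * P.ℓ := (P.window_lt_iff hs1 _).1 (Nat.lt_succ_self _)
  have hℓ := P.ℓ_pos
  have hj3 : 3 * P.Γ ≤ P.window s := by
    have h1 : 4 * P.Γ * P.ℓ ≤ (P.window s + 1) * P.ℓ := by
      refine le_trans ?_ hsj
      exact_mod_cast hs4
    have h2 := Nat.le_of_mul_le_mul_right h1 hℓ
    have h3 : 8 ≤ P.Γ := by exact_mod_cast P.eight_le_Γ
    omega
  have hlower := (hI _ (window_mono hst.le)).2 hj3
  have hsub : ∑ u ∈ P.freeTimes with P.window u < P.window s, P.denseSizeAt 1 I u ≤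
      ∑ u ∈ D, A.W I u := by
    rw [Finset.sum_congr rfl hDW, hDdef]
    rw [← Finset.sum_filter_of_ne (p := fun u => 0 < P.denseSizeAt 1 I u) fun u _ hne =>
      lt_of_le_of_ne (P.denseSizeAt_nonneg 1 I u) hne.symm]
    refine Finset.sum_le_sum_of_subset_of_nonneg (fun u hu => ?_)
      fun v _ _ => P.denseSizeAt_nonneg 1 I v
    obtain ⟨hu, hpos⟩ := Finset.mem_filter.1 hu
    obtain ⟨hu, hw⟩ := Finset.mem_filter.1 hu
    refine Finset.mem_filter.2 ⟨hu, ?_, hpos⟩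
    by_contra! h
    exact absurd (window_mono (P := P) h.le) (not_le.2 hw)
  rw [c_mul_eq hs1] at hle
  have hsL : (s : ℝ) / P.n * P.k ≤ ((P.window s : ℝ) + 1) * P.windowBudget := by
    have h1 : (s : ℝ) ≤ ((P.window s : ℝ) + 1) * P.ℓ := by exact_mod_cast hsj
    have h2 := mul_le_mul_of_nonneg_right (div_le_div_of_nonneg_right h1 P.n_pos.le) P.k_pos.le
    refine h2.trans (le_of_eq ?_)
    rw [windowBudget]
    ring
  linarith

/-- In a typical arrival order, what is selected at a free time outside the first windows is among
the densest items. -/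
theorem Typical.mul_algSel_le {t : ℕ} {I : P.Arrival} (hI : P.Typical t I) {A : P.Adversary}
    {X : P.Arrival → ℕ → ℕ → ℝ} (hX : P.IsLPChoice A X) (a₄ : ℝ) {s : ℕ} (hs : P.IsFree s)
    (hst : s < t) (hw : 4 * P.Γ ≤ P.window s) :
    A.W I s * P.algSel a₄ (A.W I) (X I) s ≤ P.denseSizeAt 1 I s := by
  obtain ⟨hs1, hsn⟩ := Finset.mem_Icc.1 hs.1
  have hW := A.W_mem I s hs.1
  have hT := P.algSel_le_T a₄ (A.W I) (X I) s
  by_cases hpick : 0 < X I s s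
  · have hs4 : 4 * (P.Γ : ℝ) * P.ℓ ≤ s := by
      have h1 : ¬ s ≤ 4 * P.Γ * P.ℓ := by
        rw [← P.window_lt_iff hs1]
        omega
      exact_mod_cast (not_le.1 h1).le
    have hmem := hI.mem_densest hX hs hst hs4 hpick
    rw [denseSizeAt_free hs, denseSize, if_pos hmem, ← A.W_free I hs]
    refine mul_le_of_le_one_right hW.1 (hT.trans ?_)
    rcases T_mem (X I) s with h | h <;> rw [h]
    exact zero_le_one
  · have h0 : T (X I) s = 0 := by
      unfold T
      rw [if_neg hpick]
    have h1 : P.algSel a₄ (A.W I) (X I) s = 0 :=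
      le_antisymm (h0 ▸ hT) (P.algSel_nonneg _ _ _ _)
    rw [h1, mul_zero]
    exact P.denseSizeAt_nonneg 1 I s

/-- In a typical arrival order, blocking forces many dense items at the free times. -/
theorem Typical.lt_sum_of_blocked {t : ℕ} (ht : P.IsFree t) (ht8 : 8 * (P.ℓ : ℝ) * (P.Γ + 2) ≤ t)
    {I : P.Arrival} (hI : P.Typical t I) {A : P.Adversary}
    {X : P.Arrival → ℕ → ℕ → ℝ} (hX : P.IsLPChoice A X) {a₄ : ℝ} (ha₄ : 602 ≤ a₄)
    (hF : P.F a₄ (A.W I) (X I) t = 0) :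
    P.k - 1 - 5 * P.Γ * (a₄ * P.windowBudget) <
      ∑ s ∈ P.freeTimes with s < t, P.denseSizeAt 1 I s := by
  classical
  obtain ⟨ht1, htn⟩ := Finset.mem_Icc.1 ht.1
  have hL := P.three_le_windowBudget
  have hwt : 4 * P.Γ ≤ P.window t := by
    by_contra! h
    have h1 := (P.window_lt_iff ht1 _).1 h
    have h2 : (t : ℝ) ≤ 4 * P.Γ * P.ℓ := by exact_mod_cast h1
    have h3 : (0 : ℝ) < P.ℓ := by exact_mod_cast P.ℓ_pos
    nlinarith [Nat.cast_nonneg (α := ℝ) P.Γ]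
  have hfree : ∀ s ∈ Ico 1 t, P.window s ∉ P.Wadv → P.IsFree s := by
    intro s hs h
    obtain ⟨h1, h2⟩ := Finset.mem_Ico.1 hs
    exact ⟨Finset.mem_Icc.2 ⟨h1, by omega⟩, h⟩
  have hwin : ∑ s ∈ Ico 1 t with P.window s = P.window t,
      A.W I s * P.algSel a₄ (A.W I) (X I) s ≤ a₄ * (P.ℓ / P.n) * P.k - 1 := by
    rw [mul_windowBudget]
    calc _ ≤ ∑ s ∈ Ico 1 t with P.window s = P.window t, P.denseSizeAt 1 I s := by
          refine Finset.sum_le_sum fun s hs => ?_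
          obtain ⟨hs, hw⟩ := Finset.mem_filter.1 hs
          exact hI.mul_algSel_le hX a₄ (hfree s hs (hw ▸ ht.2)) (Finset.mem_Ico.1 hs).2 (hw ▸ hwt)
      _ ≤ ∑ s ∈ (P.freeTimes.erase t) with P.window s = P.window t, P.denseSizeAt 1 I s := by
          refine Finset.sum_le_sum_of_subset_of_nonneg (fun s hs => ?_)
            fun v _ _ => P.denseSizeAt_nonneg 1 I v
          obtain ⟨hs, hw⟩ := Finset.mem_filter.1 hs
          refine Finset.mem_filter.2 ⟨Finset.mem_erase.2 ⟨?_, ?_⟩, hw⟩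
          · exact (Finset.mem_Ico.1 hs).2.ne
          · exact mem_freeTimes.2 (hfree s hs (hw ▸ ht.2))
      _ ≤ a₁ * P.windowBudget := (hI _ le_rfl).1
      -- Here a₄ ≥ 602 = a₁ + 1 and B ≥ 3 are used.
      _ ≤ a₄ * P.windowBudget - 1 := by
          unfold a₁
          nlinarith
  have hblock : P.k - 1 < ∑ s ∈ Ico 1 t, A.W I s * P.algSel a₄ (A.W I) (X I) s := by
    by_contra! h
    rw [F, if_pos ⟨hwin, h⟩] at hF
    exact one_ne_zero hF
  -- Windows without control over the selections: the adversarial ones, and the first 4Γ, where the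
  -- LP may be infeasible. Only the outer constraint limits them.
  set J : Finset ℕ := P.Wadv ∪ range (4 * P.Γ) with hJ
  have hJcard : (#J : ℝ) ≤ 5 * P.Γ := by
    have h1 : #J ≤ 5 * P.Γ := by
      refine (Finset.card_union_le _ _).trans ?_
      have := P.card_Wadv
      rw [Finset.card_range]
      omega
    exact_mod_cast h1
  have haL : 0 ≤ a₄ * P.windowBudget := by nlinarith
  have h1 := Finset.sum_filter_add_sum_filter_not (Ico 1 t) (fun s => P.window s ∈ J)
    (fun s => A.W I s * P.algSel a₄ (A.W I) (X I) s)
  have h2 : ∑ s ∈ Ico 1 t with P.window s ∈ J, A.W I s * P.algSel a₄ (A.W I) (X I) s ≤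
      #J * (a₄ * P.windowBudget) := by
    rw [← Finset.sum_fiberwise_of_maps_to (g := P.window) (t := J)
      (fun s hs => (Finset.mem_filter.1 hs).2), ← nsmul_eq_mul]
    refine Finset.sum_le_card_nsmul _ _ _ fun j hj => ?_
    rw [← mul_windowBudget]
    refine le_trans (le_of_eq ?_) (sum_algSel_window_le (by rwa [mul_windowBudget]) (X I)
      (fun u hu => (A.W_mem I u hu).2) j (htn.trans (Nat.le_succ _)))
    refine Finset.sum_congr ?_ fun _ _ => rfl
    ext u
    simp only [Finset.mem_filter]
    constructor
    · rintro ⟨⟨h, _⟩, h'⟩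
      exact ⟨h, h'⟩
    · rintro ⟨h, h'⟩
      exact ⟨⟨h, h' ▸ hj⟩, h'⟩
  have h3 : ∑ s ∈ Ico 1 t with P.window s ∉ J, A.W I s * P.algSel a₄ (A.W I) (X I) s ≤
      ∑ s ∈ P.freeTimes with s < t, P.denseSizeAt 1 I s := by
    have hout : ∀ s ∈ {s ∈ Ico 1 t | P.window s ∉ J},
        P.IsFree s ∧ s < t ∧ 4 * P.Γ ≤ P.window s := by
      intro s hs
      obtain ⟨hs, hw⟩ := Finset.mem_filter.1 hs
      rw [hJ, Finset.mem_union, Finset.mem_range, not_or, not_lt] at hw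
      exact ⟨hfree s hs hw.1, (Finset.mem_Ico.1 hs).2, hw.2⟩
    refine (Finset.sum_le_sum fun s hs => hI.mul_algSel_le hX a₄ (hout s hs).1 (hout s hs).2.1
      (hout s hs).2.2).trans ?_
    refine Finset.sum_le_sum_of_subset_of_nonneg (fun s hs => ?_)
      fun v _ _ => P.denseSizeAt_nonneg 1 I v
    exact Finset.mem_filter.2 ⟨mem_freeTimes.2 (hout s hs).1, (hout s hs).2.1⟩
  have h4 := mul_le_mul_of_nonneg_right hJcard haL
  linarith

theorem card_free_lt_succ_le {t : ℕ} (ht1 : 1 ≤ t) : #{s ∈ P.freeTimes | s < t} + 1 ≤ t := by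
  have h : {s ∈ P.freeTimes | s < t} ⊆ Ico 1 t := by
    intro s hs
    obtain ⟨hs, hst⟩ := Finset.mem_filter.1 hs
    exact Finset.mem_Ico.2 ⟨(Finset.mem_Icc.1 (mem_freeTimes.1 hs).1).1, hst⟩
  have := Finset.card_le_card h
  rw [Nat.card_Ico] at this
  omega

/-- The probability of being blocked. -/
theorem condProb_blocked_le {a₄ : ℝ} (ha₄ : 602 ≤ a₄) {A : P.Adversary}
    {X : P.Arrival → ℕ → ℕ → ℝ} (hX : P.IsLPChoice A X) {t : ℕ} (ht : P.IsFree t)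
    (ht8 : 8 * (P.ℓ : ℝ) * (P.Γ + 2) ≤ t) (i : Fin #P.RO) :
    P.condProb (fun I => P.F a₄ (A.W I) (X I) t = 0) ⟨t, ht.mem_RO⟩ i ≤
      P.p 6 (6 * a₄ + 4) t := by
  unfold p
  split_ifs with hδ
  swap
  · exact condProb_le_one _ _ _
  set δ := 1 - (t : ℝ) / P.n - (6 * a₄ + 4) * (P.Γ * Real.log P.k / P.k) with hδdef
  obtain ⟨ht1, htn⟩ := Finset.mem_Icc.1 ht.1
  have hk := P.k_pos
  have hn := P.n_pos
  have hlog := P.four_le_log_k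
  have hΓ := P.eight_le_Γ
  have hL := P.three_le_windowBudget
  have hLle := P.windowBudget_le
  have hS : {s ∈ P.freeTimes | s < t} ⊆ P.RO :=
    (Finset.filter_subset _ _).trans P.freeTimes_subset_RO
  have htS : t ∉ {s ∈ P.freeTimes | s < t} := by simp
  have hδ1 : δ ≤ 1 := by
    have h1 : (0 : ℝ) ≤ (t : ℝ) / P.n := by positivity
    have h2 : 0 ≤ (6 * a₄ + 4) * (P.Γ * Real.log P.k / P.k) :=
      mul_nonneg (by linarith) (by positivity)
    linarith
  set M := 1 * ((t : ℝ) / P.n * P.k) + 2 * (P.Γ * P.windowBudget) + 2 with hM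
  have hmean := mean_le zero_le_one le_rfl ⟨t, ht.mem_RO⟩ hS htS (card_free_lt_succ_le ht1)
  -- The choice a₅ = 6a₄ + 4 comes from here: B ≤ (9/8) ln k turns 5a₄ΓB into at most 6a₄Γ ln k, and
  -- 2ΓB + 3 is at most 4Γ ln k.
  have hgap : M + P.k * δ ≤ P.k - 1 - 5 * P.Γ * (a₄ * P.windowBudget) := by
    have h1 : P.k * δ = P.k - t / P.n * P.k - (6 * a₄ + 4) * (P.Γ * Real.log P.k) := by
      rw [hδdef]
      field_simp
    have h2 : P.windowBudget ≤ 9 / 8 * Real.log P.k := by linarith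
    have h3 : (P.Γ : ℝ) * P.windowBudget ≤ P.Γ * (9 / 8 * Real.log P.k) :=
      mul_le_mul_of_nonneg_left h2 (by linarith)
    have h4 : a₄ * (P.Γ * P.windowBudget) ≤ a₄ * (P.Γ * (9 / 8 * Real.log P.k)) :=
      mul_le_mul_of_nonneg_left h3 (by linarith)
    have h5 : 32 ≤ (P.Γ : ℝ) * Real.log P.k := by nlinarith
    have h6 : 0 ≤ a₄ * ((P.Γ : ℝ) * Real.log P.k) := mul_nonneg (by linarith) (by linarith)
    rw [h1, hM]
    nlinarith
  have hMk : M ≤ P.k := by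
    have h1 : 0 ≤ P.Γ * (a₄ * P.windowBudget) :=
      mul_nonneg (by linarith) (mul_nonneg (by linarith) (by linarith))
    have h2 : 0 < P.k * δ := mul_pos hk hδ
    linarith
  have hcheb := condProb_ge_le_exp_sq ⟨t, ht.mem_RO⟩ i hS htS hk hMk (mul_pos hk hδ).le
    (by nlinarith) hmean
  -- By exp(-x) ≤ 1/x. Together with 2/k ≤ 2/(kδ²) for atypical orders this yields C = 6.
  have hexp : Real.exp (-((P.k * δ) ^ 2 / (4 * P.k))) ≤ 4 / (P.k * δ ^ 2) := by
    have h1 : (P.k * δ) ^ 2 / (4 * P.k) = P.k * δ ^ 2 / 4 := by field_simp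
    have h2 : 0 < P.k * δ ^ 2 / 4 := by positivity
    have h3 : 4 / (P.k * δ ^ 2) = (P.k * δ ^ 2 / 4)⁻¹ := by rw [inv_div]
    rw [h1, h3, Real.exp_neg]
    exact inv_anti₀ h2 (by linarith [Real.add_one_le_exp (P.k * δ ^ 2 / 4)])
  have htyp := condProb_not_typical_le (P := P) ⟨t, ht.mem_RO⟩ i
  have htyp2 : 2 / P.k ≤ 2 / (P.k * δ ^ 2) := by
    refine div_le_div_of_nonneg_left (by norm_num) (by positivity) ?_
    exact mul_le_of_le_one_right hk.le (pow_le_one₀ hδ.le hδ1)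
  calc _ ≤ P.condProb (fun I => ¬ P.Typical t I ∨
        M + P.k * δ ≤ ∑ s ∈ P.freeTimes with s < t, P.denseSizeAt 1 I s) ⟨t, ht.mem_RO⟩ i := by
        refine condProb_mono fun I _ hF => ?_
        by_cases hI : P.Typical t I
        · exact Or.inr (hgap.trans (hI.lt_sum_of_blocked ht ht8 hX ha₄ hF).le)
        · exact Or.inl hI
    _ ≤ 2 / (P.k * δ ^ 2) + 4 / (P.k * δ ^ 2) :=
        (condProb_or_le _ _ _ _).trans
          (add_le_add (htyp.trans htyp2) (hcheb.trans hexp))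
    _ = 6 / (P.k * δ ^ 2) := by ring

/-- A dense item arriving at a free time is hardly ever not tentatively selected. -/
theorem condProb_not_selected_le {A : P.Adversary} {X : P.Arrival → ℕ → ℕ → ℝ}
    (hX : P.IsLPChoice A X) {t : ℕ} (ht : P.IsFree t) (ht4 : 1212 * (P.Γ : ℝ) * P.ℓ ≤ t)
    (hγ : 0 < P.c t - P.ε t) {i : Fin #P.RO} (hi : i ∈ P.densest (P.c t - P.ε t)) :
    P.condProb (fun I => T (X I) t = 0) ⟨t, ht.mem_RO⟩ i ≤ 2 / P.k := by
  classical
  obtain ⟨ht1, htn⟩ := Finset.mem_Icc.1 ht.1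
  have hk := P.k_pos
  have hn := P.n_pos
  have hlog := P.four_le_log_k
  have hΓ := P.eight_le_Γ
  have hL := P.three_le_windowBudget
  have htpos : (0 : ℝ) < t := by exact_mod_cast ht1
  set γ := P.c t - P.ε t with hγdef
  set K := (t : ℝ) / P.n * P.k with hK
  have hKpos : 0 < K := by positivity
  set d := Real.sqrt (10 * Real.log P.k) * Real.sqrt (2 * P.n / (t * P.k)) with hd
  have hd0 : 0 ≤ d := by positivity
  have hdsq : d ^ 2 = 20 * Real.log P.k / K := by
    rw [hd, mul_pow, Real.sq_sqrt (by linarith), Real.sq_sqrt (by positivity), hK]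
    field_simp
    ring
  have hu0 : 0 ≤ (P.Γ : ℝ) * P.ℓ / t := by positivity
  have huK : (P.Γ : ℝ) * P.ℓ / t * K = P.Γ * P.windowBudget := by
    rw [hK, windowBudget]
    field_simp
  -- The 608 units of ΓB cover 4 for c_t, 601 for the adversarial windows, 2 for the error in
  -- `mean_le`, and 1 to spare for its additive 2.
  have hγeq : γ = 1 - 608 * ((P.Γ : ℝ) * P.ℓ / t) - d := by
    rw [hγdef, c, ε, a₁, ← hd]
    ring
  have hγ1 : γ ≤ 1 := by linarith
  have hγK : γ * K = K - 608 * (P.Γ * P.windowBudget) - d * K := by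
    rw [hγeq, ← huK]
    ring
  have hΓL : 24 ≤ (P.Γ : ℝ) * P.windowBudget := by nlinarith
  set S := {s ∈ P.freeTimes | s < t} with hSdef
  have hS : S ⊆ P.RO := (Finset.filter_subset _ _).trans P.freeTimes_subset_RO
  have htS : t ∉ S := by simp [hSdef]
  have hS1 : ∀ s ∈ S, 1 ≤ s := fun s hs => (Finset.mem_Icc.1 (P.RO_subset (hS hs))).1
  have hmean := mean_le hγ.le hγ1 ⟨t, ht.mem_RO⟩ hS htS (card_free_lt_succ_le ht1)
  have hprob1 := condProb_window_le hγ.le hγ1 ⟨t, ht.mem_RO⟩ i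
    ((Finset.filter_subset (fun s => P.window s = P.window t) S).trans hS)
    (fun h => htS (Finset.mem_filter.1 h).1) (P.card_filter_window_le hS1 _)
  have hdK : 0 ≤ d * K := by positivity
  have hprob2 := condProb_ge_le_exp_sq ⟨t, ht.mem_RO⟩ i hS htS hKpos
    (M := γ * K + 2 * (P.Γ * P.windowBudget) + 2) (D := d * K) (by linarith) hdK
    (mul_le_mul_of_nonneg_right (by linarith) hKpos.le) hmean
  -- The factor 10·2 under the roots of ε_t makes this exponent 5 ln k.
  have hexp : Real.exp (-((d * K) ^ 2 / (4 * K))) ≤ 1 / P.k := by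
    have h1 : (d * K) ^ 2 / (4 * K) = 5 * Real.log P.k := by
      rw [mul_pow, hdsq]
      field_simp
      ring
    rw [h1, ← pow_one P.k, ← exp_neg_mul_log_k, Real.exp_le_exp, pow_one]
    push_cast
    linarith
  have hk2 : 1 / P.k ^ 2 ≤ 1 / P.k :=
    one_div_le_one_div_of_le hk (by nlinarith [P.k_ge])
  have hdet : ∀ I : P.Arrival, I ⟨t, ht.mem_RO⟩ = i → T (X I) t = 0 →
      a₁ * P.windowBudget ≤ ∑ s ∈ S with P.window s = P.window t, P.denseSizeAt γ I s ∨
      γ * K + 2 * (P.Γ * P.windowBudget) + 2 + d * K ≤ ∑ s ∈ S, P.denseSizeAt γ I s := by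
    intro I hIt hT
    have hfeas := lpFeasible_zero (P := P) (A.W I) ht1 (by nlinarith [Nat.cast_nonneg (α := ℝ) P.ℓ])
    have hopt := hX I t ht.1 ⟨_, hfeas⟩
    have hx0 : X I t t = 0 := by
      refine le_antisymm ?_ (hopt.1.1 t (Finset.mem_Icc.2 ⟨ht1, le_rfl⟩)).1
      by_contra! h
      rw [T, if_pos h] at hT
      exact one_ne_zero hT
    set D : Finset ℕ := {u ∈ S | 0 < P.denseSizeAt γ I u} with hD
    have hDW : ∀ u ∈ D, A.W I u = P.denseSizeAt γ I u := by
      intro u hu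
      obtain ⟨hu, hpos⟩ := Finset.mem_filter.1 hu
      exact A.W_eq_denseSizeAt (mem_freeTimes.1 (Finset.mem_filter.1 hu).1) hpos
    have hWt : A.W I t = P.w i := by rw [A.W_free I ht, hIt]
    have hVt : A.V I t = P.v i := by rw [A.V_free I ht, hIt]
    have h := hopt.le_sum_denser (Finset.mem_Icc.2 ⟨ht1, le_rfl⟩)
      (fun u hu => (A.W_mem I u (Finset.mem_Icc.2 ⟨(Finset.mem_Icc.1 hu).1,
        (Finset.mem_Icc.1 hu).2.trans htn⟩)).1)
      (by rw [hWt]; exact P.w_pos i) (by rw [hVt]; exact P.v_pos i) hx0 P.Wadv ht.2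
      (D := D) (by
        intro u hu hw hdens
        obtain ⟨hu1, hut⟩ := Finset.mem_Ico.1 hu
        have hfree : P.IsFree u := ⟨Finset.mem_Icc.2 ⟨hu1, by omega⟩, hw⟩
        refine Finset.mem_filter.2 ⟨Finset.mem_filter.2 ⟨mem_freeTimes.2 hfree, hut⟩, ?_⟩
        rw [denseSizeAt_free hfree, denseSize_pos_iff]
        refine densest_upper hi ?_
        rw [hWt, hVt, A.W_free I hfree, A.V_free I hfree] at hdens
        rwa [div_le_div_iff₀ (P.w_pos _) (P.w_pos _)])
      (fun u hu => by rw [hDW u hu]; exact P.denseSizeAt_nonneg γ I u)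
    rw [mul_windowBudget, c_mul_eq ht1] at h
    rcases h with h | h
    · left
      refine h.trans ?_
      rw [Finset.sum_congr rfl fun v hv => hDW v (Finset.mem_filter.1 hv).1]
      exact Finset.sum_le_sum_of_subset_of_nonneg
        (Finset.filter_subset_filter _ (Finset.filter_subset _ _))
        fun v _ _ => P.denseSizeAt_nonneg γ I v
    · right
      have h1 : ∑ u ∈ D, A.W I u ≤ ∑ s ∈ S, P.denseSizeAt γ I s := by
        rw [Finset.sum_congr rfl hDW]
        exact Finset.sum_le_sum_of_subset_of_nonneg (Finset.filter_subset _ _)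
          fun v _ _ => P.denseSizeAt_nonneg γ I v
      have h2 : (#P.Wadv : ℝ) * (a₁ * P.windowBudget) ≤ P.Γ * (a₁ * P.windowBudget) :=
        mul_le_mul_of_nonneg_right (by exact_mod_cast P.card_Wadv) P.a₁_mul_nonneg
      have h3 : (P.Γ : ℝ) * (a₁ * P.windowBudget) = 601 * (P.Γ * P.windowBudget) := by
        rw [a₁]
        ring
      linarith
  calc _ ≤ 1 / P.k ^ 2 + Real.exp (-((d * K) ^ 2 / (4 * K))) :=
        (condProb_mono hdet).trans ((condProb_or_le _ _ _ _).trans (add_le_add hprob1 hprob2))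
    _ ≤ 1 / P.k + 1 / P.k := add_le_add hk2 hexp
    _ = 2 / P.k := by ring

end Blocking

/-! ### The collected value -/

theorem p_nonneg {P : BARO} {C : ℝ} (hC : 0 ≤ C) (a₅ : ℝ) (t : ℕ) : 0 ≤ P.p C a₅ t := by
  have := P.k_pos
  unfold p
  split_ifs <;> positivity

theorem expect_nonneg {P : BARO} {f : P.Arrival → ℝ} (hf : ∀ I, 0 ≤ f I) : 0 ≤ P.expect f :=
  div_nonneg (Finset.sum_nonneg fun I _ => hf I) (Nat.cast_nonneg _)

theorem OPT_nonneg (P : BARO) : 0 ≤ P.OPT := by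
  refine Real.sSup_nonneg ?_
  rintro y ⟨x, hx, -, rfl⟩
  exact Finset.sum_nonneg fun i _ => mul_nonneg (P.v_pos i).le (hx i).1

/-- The expected value collected at a time, restricted to a set of items that are likely to be
picked when they arrive. -/
theorem le_expect_of_condProb_le {P : BARO} (t : P.RO) {U : Finset (Fin #P.RO)} {b b' : ℝ}
    {τ φ : P.Arrival → ℝ} (hτ : ∀ I, τ I = 0 ∨ τ I = 1) (hφ : ∀ I, φ I = 0 ∨ φ I = 1)
    (hb : ∀ i ∈ U, P.condProb (fun I => τ I = 0) t i ≤ b)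
    (hb' : ∀ i ∈ U, P.condProb (fun I => φ I = 0) t i ≤ b') :
    (1 - b - b') * (∑ i ∈ U, P.v i) / #P.RO ≤ P.expect fun I => P.v (I t) * τ I * φ I := by
  classical
  have hcard : ∀ i, (#P.RO : ℝ) * #{I : P.Arrival | I t = i} = Fintype.card P.Arrival := by
    intro i
    have := card_mul_card_equiv_fixing (α := P.RO) t i
    rw [Fintype.card_fin] at this
    exact_mod_cast this
  have hN : (0 : ℝ) < #P.RO := by linarith [P.half_n_le_card_RO, P.n_pos]
  have hpos : (0 : ℝ) < Fintype.card P.Arrival := by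
    exact_mod_cast Fintype.card_pos_iff.2 ⟨P.RO.equivFin⟩
  have hτφ : ∀ I, 0 ≤ τ I * φ I := by
    intro I
    rcases hτ I with h | h <;> rcases hφ I with h' | h' <;> simp [h, h']
  have hone : ∀ i ∈ U, (1 - b - b') * P.v i * #{I : P.Arrival | I t = i} ≤
      ∑ I : P.Arrival with I t = i, P.v (I t) * τ I * φ I := by
    intro i hi
    have hc : (0 : ℝ) < #{I : P.Arrival | I t = i} := by
      exact_mod_cast card_arrival_fixing_pos t i
    have h1 := hb i hi
    have h2 := hb' i hi
    rw [condProb_eq_sum, div_le_iff₀ hc] at h1 h2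
    -- The union bound, pointwise: 1 - [τ = 0] - [φ = 0] ≤ τφ.
    have h3 : (#{I : P.Arrival | I t = i} : ℝ) -
        (∑ I : P.Arrival with I t = i, if τ I = 0 then (1 : ℝ) else 0) -
        (∑ I : P.Arrival with I t = i, if φ I = 0 then (1 : ℝ) else 0) ≤
        ∑ I : P.Arrival with I t = i, τ I * φ I := by
      rw [Finset.card_eq_sum_ones, Nat.cast_sum, ← Finset.sum_sub_distrib,
        ← Finset.sum_sub_distrib]
      refine Finset.sum_le_sum fun I _ => ?_
      rcases hτ I with h | h <;> rcases hφ I with h' | h' <;> simp [h, h']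
    have h4 : ∑ I : P.Arrival with I t = i, P.v (I t) * τ I * φ I =
        P.v i * ∑ I : P.Arrival with I t = i, τ I * φ I := by
      rw [Finset.mul_sum]
      refine Finset.sum_congr rfl fun I hI => ?_
      rw [(Finset.mem_filter.1 hI).2, mul_assoc]
    rw [h4, mul_comm (1 - b - b'), mul_assoc]
    refine mul_le_mul_of_nonneg_left ?_ (P.v_pos i).le
    linarith
  have hsplit : ∑ I : P.Arrival, P.v (I t) * τ I * φ I =
      ∑ i, ∑ I : P.Arrival with I t = i, P.v (I t) * τ I * φ I :=
    (Finset.sum_fiberwise _ _ _).symm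
  have hsum : ∑ i ∈ U, (1 - b - b') * P.v i * #{I : P.Arrival | I t = i} ≤
      ∑ I : P.Arrival, P.v (I t) * τ I * φ I := by
    rw [hsplit]
    refine (Finset.sum_le_sum hone).trans (Finset.sum_le_univ_sum_of_nonneg fun i => ?_)
    refine Finset.sum_nonneg fun I _ => ?_
    rw [mul_assoc]
    exact mul_nonneg (P.v_pos _).le (hτφ I)
  rw [expect, le_div_iff₀ hpos]
  refine le_trans (le_of_eq ?_) hsum
  rw [Finset.mul_sum, Finset.sum_div, Finset.sum_mul]
  refine Finset.sum_congr rfl fun i _ => ?_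
  rw [← hcard i]
  field_simp

theorem le_expect_collected {P : BARO} {a₄ : ℝ} (ha₄ : 602 ≤ a₄) {A : P.Adversary}
    {X : P.Arrival → ℕ → ℕ → ℝ} (hX : P.IsLPChoice A X) {t : ℕ} (ht : P.IsFree t)
    (ht4 : 1212 * (P.Γ : ℝ) * P.ℓ ≤ t) :
    (P.c t - P.ε t - P.p 6 (6 * a₄ + 4) t - 2 / P.k) * (P.OPT / #P.RO) ≤
      P.expect fun I => A.V I t * T (X I) t * P.F a₄ (A.W I) (X I) t := by
  have hk := P.k_pos
  have hΓ := P.eight_le_Γ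
  have hp := p_nonneg (P := P) (C := 6) (by norm_num) (6 * a₄ + 4) t
  have hOPT : 0 ≤ P.OPT / #P.RO := div_nonneg P.OPT_nonneg (Nat.cast_nonneg _)
  have hk2 : 0 < 2 / P.k := by positivity
  have hE0 : 0 ≤ P.expect fun I => A.V I t * T (X I) t * P.F a₄ (A.W I) (X I) t := by
    refine expect_nonneg fun I => ?_
    have hV := A.V_nonneg I t ht.1
    rcases T_mem (X I) t with h | h <;> rcases P.F_mem a₄ (A.W I) (X I) t with h' | h' <;>
      simp [h, h', hV]
  -- A nonpositive factor makes the claim trivial; otherwise γ = c_t - ε_t is a legitimate parameter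
  -- in (0, 1].
  by_cases hneg : P.c t - P.ε t - P.p 6 (6 * a₄ + 4) t - 2 / P.k ≤ 0
  · exact (mul_nonpos_of_nonpos_of_nonneg hneg hOPT).trans hE0
  push Not at hneg
  set q := P.p 6 (6 * a₄ + 4) t with hq
  have hγ : 0 < P.c t - P.ε t := by linarith
  have hγ1 : P.c t - P.ε t ≤ 1 := by
    have h1 : 0 ≤ P.ε t := by
      unfold ε a₁
      positivity
    have h2 : 0 ≤ 4 * (P.Γ : ℝ) * P.ℓ / t := by positivity
    rw [c]
    linarith
  have ht8 : 8 * (P.ℓ : ℝ) * (P.Γ + 2) ≤ t := by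
    refine le_trans ?_ ht4
    nlinarith [Nat.cast_nonneg (α := ℝ) P.ℓ]
  have hmain := le_expect_of_condProb_le ⟨t, ht.mem_RO⟩ (U := P.densest (P.c t - P.ε t))
    (fun I => T_mem (X I) t) (fun I => P.F_mem a₄ (A.W I) (X I) t)
    (fun i hi => condProb_not_selected_le hX ht ht4 hγ hi)
    (fun i _ => condProb_blocked_le ha₄ hX ht ht8 i)
  simp only [← A.V_free _ ht] at hmain
  refine le_trans ?_ hmain
  rw [← hq, mul_div_assoc']
  refine div_le_div_of_nonneg_right ?_ (Nat.cast_nonneg _)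
  have h1 := P.mul_OPT_le_sum_densest hγ hγ1
  have h2 : 0 ≤ 1 - 2 / P.k - q := by linarith
  refine le_trans ?_ (mul_le_mul_of_nonneg_left h1 h2)
  rw [← mul_assoc]
  refine mul_le_mul_of_nonneg_right ?_ P.OPT_nonneg
  -- As γ ≤ 1, γ(1 - 2/k - q) ≥ γ - q - 2/k.
  nlinarith

end BARO

theorem mainTheorem4 :
    ∃ A₄ : ℝ, ∀ a₄ : ℝ, A₄ ≤ a₄ → ∃ C > (0 : ℝ), ∃ a₅ > (0 : ℝ),
      ∀ (P : BARO) (A : P.Adversary) (X : P.Arrival → ℕ → ℕ → ℝ), P.IsLPChoice A X →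
        ∀ (t : ℕ) (ht : P.IsFree t),
          (8 * (P.ℓ : ℝ) * (P.Γ + 2) ≤ t → ∀ i : Fin P.RO.card,
            P.condProb (fun I => P.F a₄ (A.W I) (X I) t = 0) ⟨t, ht.mem_RO⟩ i ≤ P.p C a₅ t) ∧
          (1212 * (P.Γ : ℝ) * P.ℓ ≤ t →
            (P.c t - P.ε t - P.p C a₅ t - 2 / P.k) * (P.OPT / P.RO.card) ≤
              P.expect fun I => A.V I t * BARO.T (X I) t * P.F a₄ (A.W I) (X I) t) := by
  refine ⟨602, fun a₄ ha₄ => ⟨6, by norm_num, 6 * a₄ + 4, by linarith, ?_⟩⟩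
  intro P A X hX t ht
  exact ⟨fun ht8 i => BARO.condProb_blocked_le ha₄ hX ht ht8 i,
    fun ht4 => BARO.le_expect_collected ha₄ hX ht ht4⟩
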